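/- Let $\varepsilon,\mu>0$ be constants. There is a constant $C>0$ depending only on $\varepsilon$ and $\mu$ such that the following holds. **Setting.** Let $0<R<\rho$, $\sigma_0>0$, $T>0$, let $m\ge 1$ be an integer, and let $\Omega\subset\mathbb R^3$ be an open set with $\overline\Omega\subset B_R=\{|x|<R\}$ (for instance a bounded Lipschitz domain) with boundary $\Gamma$. Put $\Omega_\rho=B_\rho\setminus\overline\Omega$, $\Omega_R=B_R\setminus\overline\Omega$ and $\Gamma_\rho=\{|x|=\rho\}$. With $s_1=1/T$ and $r=|x|$ let $$\sigma(r)=\begin{cases}0,&0\le r\le R,\\ \sigma_0\big(\tfrac{r-R}{\rho-R}\big)^m,&R\le r\le\rho,\\ \sigma_0,&r\ge\rho,\end{cases}\qquad \alpha(r)=1+s_1^{-1}\sigma(r),\qquad \beta(r)=\frac1r\int_0^r\alpha(\tau)\,d\tau ,$$ and let $A=\mathrm{diag}\{\beta^{-2},\alpha^{-1}\beta^{-1},\alpha^{-1}\beta^{-1}\}$, $B=\mathrm{diag}\{\alpha,\beta,\beta\}$ with respect to the spherical basis $\{e_r,e_\theta,e_\phi\}$. Let $H(\mathrm{curl},\Omega_\rho)=\{u\in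 L^2(\Omega_\rho)^3:\nabla\times u\in L^2(\Omega_\rho)^3\}$, and let $H_0(\mathrm{curl},\Omega_\rho)$ be its subspace of fields with zero tangential trace on $\partial\Omega_\rho$, where the tangential trace of $u$ is understood as the functional $v\mapsto (u,\nabla\times v)_{\Omega_\rho}-(\nabla\times u,v)_{\Omega_\rho}$ on $H(\mathrm{curl},\Omega_\rho)$. Elements of $H^1(0,T;L^2)$ are identified with their continuous representatives on $[0,T]$. The fields may be real- or complex-valued. Let $J\in H^1(0,T;L^2(\Omega_R)^3)$ with $J|_{t=0}=0$, extended by zero to $\Omega_\rho$. **Well-posedness.** The truncated PML problem $$\begin{cases}\nabla\times E^p+\mu(BA)^{-1}\partial_tH^p=0&\text{in }\Omega_\rho\times(0,T),\\ \nabla\times H^p-\varepsilon(BA)^{-1}\partial_tE^p=J&\text{in }\Omega_\rho\times(0,T),\\ n\times E^p=0&\text{on }\Gamma\times(0,T),\\ \hat x\times E^p=0&\text{on }\Gamma_\rho\times(0,T),\\ E^p(\cdot,0)=H^p(\cdot,0)=0&\text{in }\Omega_\rho\end{cases}$$ has a unique solution $(E^p,H^p)$ with $$E^p\in L^2(0,T;H_0(\mathrm{curl},\Omega_\rho))\cap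 H^1(0,T;L^2(\Omega_\rho)^3),\qquad H^p\in L^2(0,T;H(\mathrm{curl},\Omega_\rho))\cap H^1(0,T;L^2(\Omega_\rho)^3).$$ **Stability.** Moreover $E^p,H^p\in C^1([0,T];L^2(\Omega_\rho)^3)$, $E^p(t)\in H_0(\mathrm{curl},\Omega_\rho)$ and $H^p(t)\in H(\mathrm{curl},\Omega_\rho)$ for every $t\in[0,T]$, $\nabla\times E^p,\nabla\times H^p\in C([0,T];L^2(\Omega_\rho)^3)$, and $$\max_{t\in[0,T]}\Big[\|\partial_tE^p\|_{L^2(\Omega_\rho)^3}+\|\nabla\times E^p\|_{L^2(\Omega_\rho)^3}+\|\partial_tH^p\|_{L^2(\Omega_\rho)^3}+\|\nabla\times H^p\|_{L^2(\Omega_\rho)^3}\Big]\le C\,\max\{1,\sqrt T\}\,(1+\sigma_0T)^2\,\|J\|_{H^1(0,T;L^2(\Omega_R)^3)} .$$ In particular, the left-hand side is $\lesssim(1+\sigma_0T)^2\|J\|_{H^1(0,T;L^2(\Omega_R)^3)}$, with a hidden constant that depends only on $\varepsilon,\mu$ when $T\le 1$, and only on $\varepsilon,\mu,T$ in general. -/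

import Mathlib

open MeasureTheory Set
open scoped ContDiff

noncomputable section

namespace PML

/-- Euclidean three-space. -/
abbrev R3 := EuclideanSpace ℝ (Fin 3)

/-- `L²(D)³`, for fields with values in `𝕜³` (`𝕜 = ℝ` or `ℂ`). -/
abbrev L2Field (𝕜 : Type*) [RCLike 𝕜] (D : Set R3) :=
  Lp (EuclideanSpace 𝕜 (Fin 3)) 2 (volume.restrict D)

/-! ### The spaces `H(curl, D)` and `H_S(curl, D)` -/

/-- The partial derivative `∂_i φ_j (x)`. -/
def partialD (φ : R3 → R3) (i j : Fin 3) (x : R3) : ℝ :=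
  fderiv ℝ φ x (EuclideanSpace.single i 1) j

/-- The classical curl of a smooth vector field. -/
def classicalCurl (φ : R3 → R3) (x : R3) : Fin 3 → ℝ :=
  ![partialD φ 1 2 x - partialD φ 2 1 x,
    partialD φ 2 0 x - partialD φ 0 2 x,
    partialD φ 0 1 x - partialD φ 1 0 x]

/-- `w = ∇ × u` in `D` in the sense of distributions. -/
def IsWeakCurl {𝕜 : Type*} [RCLike 𝕜] (D : Set R3) (u w : L2Field 𝕜 D) : Prop :=
  ∀ φ : R3 → R3, ContDiff ℝ ∞ φ → HasCompactSupport φ → tsupport φ ⊆ D →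
    ∫ x in D, ∑ i, classicalCurl φ x i • u x i = ∫ x in D, ∑ i, φ x i • w x i

/-- `H(curl, D) = {u ∈ L²(D)³ : ∇ × u ∈ L²(D)³}`. -/
def HCurl (𝕜 : Type*) [RCLike 𝕜] (D : Set R3) : Set (L2Field 𝕜 D) :=
  {u | ∃ w, IsWeakCurl D u w}

open Classical in
/-- The field `∇ × u ∈ L²(D)³` for `u ∈ H(curl, D)` (and `0` for other `u`). -/
def weakCurl {𝕜 : Type*} [RCLike 𝕜] (D : Set R3) (u : L2Field 𝕜 D) : L2Field 𝕜 D :=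
  if h : ∃ w, IsWeakCurl D u w then h.choose else 0

/-- `H_S(curl, D)`: the fields `u ∈ H(curl, D)` whose tangential trace `u × n` vanishes on the part
`S` of the boundary of `D`. The trace is the functional
`v ↦ (u, ∇ × v)_D - (∇ × u, v)_D` on `H(curl, D)`; it vanishes on `S` if it vanishes on all
`v ∈ H(curl, D)` that are zero near the rest of the boundary. -/
def HCurlZeroOn (𝕜 : Type*) [RCLike 𝕜] (D S : Set R3) : Set (L2Field 𝕜 D) :=
  {u | u ∈ HCurl 𝕜 D ∧ ∀ v ∈ HCurl 𝕜 D,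
    (∃ U : Set R3, IsOpen U ∧ frontier D \ S ⊆ U ∧
      ∀ᵐ x ∂(volume.restrict D), x ∈ U → v x = 0) →
    inner 𝕜 u (weakCurl D v) = inner 𝕜 (weakCurl D u) v}

/-- `H₀(curl, D)`: zero tangential trace on the whole boundary (the condition "zero near the rest
of the boundary" is then empty). -/
def HCurl0 (𝕜 : Type*) [RCLike 𝕜] (D : Set R3) : Set (L2Field 𝕜 D) :=
  HCurlZeroOn 𝕜 D (frontier D)

/-! ### Functions of time with values in a Banach space -/

/-- `v ∈ L²(0,T;X)` is the weak derivative of `u` on `(0,T)`. -/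
def IsWeakTimeDeriv {X : Type*} [NormedAddCommGroup X] [NormedSpace ℝ X]
    (T : ℝ) (u v : ℝ → X) : Prop :=
  MemLp v 2 (volume.restrict (Ioo 0 T)) ∧
  ∀ φ : ℝ → ℝ, ContDiff ℝ ∞ φ → HasCompactSupport φ → tsupport φ ⊆ Ioo 0 T →
    ∫ t in Ioo 0 T, deriv φ t • u t = -∫ t in Ioo 0 T, φ t • v t

/-- `u ∈ H¹(0,T;X)`. Elements of `H¹(0,T;X)` are identified with their continuous representative
on `[0,T]`, so that initial values are point values. -/
def MemH1 {X : Type*} [NormedAddCommGroup X] [NormedSpace ℝ X] (T : ℝ) (u : ℝ → X) : Prop :=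
  ContinuousOn u (Icc 0 T) ∧ MemLp u 2 (volume.restrict (Ioo 0 T)) ∧ ∃ v, IsWeakTimeDeriv T u v

open Classical in
/-- The weak derivative `∂ₜ u ∈ L²(0,T;X)` of `u ∈ H¹(0,T;X)` (and `0` if there is none). -/
def weakTimeDeriv {X : Type*} [NormedAddCommGroup X] [NormedSpace ℝ X]
    (T : ℝ) (u : ℝ → X) : ℝ → X :=
  if h : ∃ v, IsWeakTimeDeriv T u v then h.choose else 0

/-- The norm of `H¹(0,T;X)`. -/
def H1Norm {X : Type*} [NormedAddCommGroup X] [NormedSpace ℝ X] (T : ℝ) (u : ℝ → X) : ℝ :=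
  Real.sqrt (∫ t in Ioo 0 T, (‖u t‖ ^ 2 + ‖weakTimeDeriv T u t‖ ^ 2))

/-- `u ∈ L²(0,T;V)`, where `V` is a subspace of `H(curl, D)` with the norm
`(‖u‖² + ‖∇ × u‖²)^{1/2}`. -/
def MemL2HCurl {𝕜 : Type*} [RCLike 𝕜] (T : ℝ) (D : Set R3) (V : Set (L2Field 𝕜 D))
    (u : ℝ → L2Field 𝕜 D) : Prop :=
  (∀ᵐ t ∂(volume.restrict (Ioo 0 T)), u t ∈ V) ∧
  MemLp u 2 (volume.restrict (Ioo 0 T)) ∧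
  MemLp (fun t => weakCurl D (u t)) 2 (volume.restrict (Ioo 0 T))

/-! ### The PML medium -/

/-- The absorbing profile `σ(r)`. -/
def sigma (σ₀ R ρ : ℝ) (m : ℕ) (r : ℝ) : ℝ :=
  if r ≤ R then 0 else if r ≤ ρ then σ₀ * ((r - R) / (ρ - R)) ^ m else σ₀

/-- `α(r) = 1 + s₁⁻¹ σ(r)`. -/
def alpha (s₁ σ₀ R ρ : ℝ) (m : ℕ) (r : ℝ) : ℝ := 1 + s₁⁻¹ * sigma σ₀ R ρ m r

/-- `β(r) = r⁻¹ ∫₀^r α(τ) dτ`. -/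
def beta (s₁ σ₀ R ρ : ℝ) (m : ℕ) (r : ℝ) : ℝ :=
  r⁻¹ * ∫ τ in (0 : ℝ)..r, alpha s₁ σ₀ R ρ m τ

/-- The Cartesian matrix, at the point `x`, of the linear map that is `diag{a, b, b}` in the
spherical basis `{e_r, e_θ, e_φ}`, namely `a e_r e_rᵀ + b (I - e_r e_rᵀ)` with `e_r = x / |x|`. -/
def radialDiag (a b : ℝ) (x : R3) : Matrix (Fin 3) (Fin 3) ℝ :=
  a • Matrix.vecMulVec (fun i => x i / ‖x‖) (fun i => x i / ‖x‖) +
  b • (1 - Matrix.vecMulVec (fun i => x i / ‖x‖) (fun i => x i / ‖x‖))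

/-- `A = diag{β⁻², α⁻¹β⁻¹, α⁻¹β⁻¹}`. -/
def matA (s₁ σ₀ R ρ : ℝ) (m : ℕ) (x : R3) : Matrix (Fin 3) (Fin 3) ℝ :=
  radialDiag ((beta s₁ σ₀ R ρ m ‖x‖) ^ 2)⁻¹
    ((alpha s₁ σ₀ R ρ m ‖x‖)⁻¹ * (beta s₁ σ₀ R ρ m ‖x‖)⁻¹) x

/-- `B = diag{α, β, β}`. -/
def matB (s₁ σ₀ R ρ : ℝ) (m : ℕ) (x : R3) : Matrix (Fin 3) (Fin 3) ℝ :=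
  radialDiag (alpha s₁ σ₀ R ρ m ‖x‖) (beta s₁ σ₀ R ρ m ‖x‖) x

/-- The vector `(BA)⁻¹ v` at the point `x`. -/
def medium {𝕜 : Type*} [RCLike 𝕜] (s₁ σ₀ R ρ : ℝ) (m : ℕ) (x : R3)
    (v : EuclideanSpace 𝕜 (Fin 3)) : EuclideanSpace 𝕜 (Fin 3) :=
  WithLp.toLp 2 fun i =>
    ∑ j, ((matB s₁ σ₀ R ρ m x * matA s₁ σ₀ R ρ m x)⁻¹ i j) • v j

/-! ### The truncated PML problem -/

/-- `Ω_ρ = B_ρ \ closure Ω`. -/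
def truncDomain (Ω : Set R3) (ρ : ℝ) : Set R3 := Metric.ball 0 ρ \ closure Ω

/-- `(E, H)` solves the truncated PML problem with parameter `s₁` in `Ω_ρ × (0,T)`, in the class
`E ∈ L²(0,T;H₀(curl, Ω_ρ)) ∩ H¹(0,T;L²(Ω_ρ)³)`, `H ∈ L²(0,T;H(curl, Ω_ρ)) ∩ H¹(0,T;L²(Ω_ρ)³)`. -/
structure IsSolution {𝕜 : Type*} [RCLike 𝕜] (ε μ s₁ σ₀ R ρ T : ℝ) (m : ℕ) (Ω : Set R3)
    (J E H : ℝ → L2Field 𝕜 (truncDomain Ω ρ)) : Prop where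
  E_space : MemL2HCurl T (truncDomain Ω ρ) (HCurl0 𝕜 (truncDomain Ω ρ)) E
  E_time : MemH1 T E
  H_space : MemL2HCurl T (truncDomain Ω ρ) (HCurl 𝕜 (truncDomain Ω ρ)) H
  H_time : MemH1 T H
  /-- `∇ × E + μ (BA)⁻¹ ∂ₜH = 0` in `Ω_ρ × (0,T)`. -/
  faraday : ∀ᵐ t ∂(volume.restrict (Ioo 0 T)), ∀ᵐ x ∂(volume.restrict (truncDomain Ω ρ)),
    weakCurl (truncDomain Ω ρ) (E t) x
      + μ • medium s₁ σ₀ R ρ m x (weakTimeDeriv T H t x) = 0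
  /-- `∇ × H - ε (BA)⁻¹ ∂ₜE = J` in `Ω_ρ × (0,T)`. -/
  ampere : ∀ᵐ t ∂(volume.restrict (Ioo 0 T)), ∀ᵐ x ∂(volume.restrict (truncDomain Ω ρ)),
    weakCurl (truncDomain Ω ρ) (H t) x
      - ε • medium s₁ σ₀ R ρ m x (weakTimeDeriv T E t x) = J t x
  /-- `n × E = 0` on `Γ × (0,T)`. -/
  pec_inner : ∀ᵐ t ∂(volume.restrict (Ioo 0 T)),
    E t ∈ HCurlZeroOn 𝕜 (truncDomain Ω ρ) (frontier Ω)
  /-- `x̂ × E = 0` on `Γ_ρ × (0,T)`. -/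
  pec_outer : ∀ᵐ t ∂(volume.restrict (Ioo 0 T)),
    E t ∈ HCurlZeroOn 𝕜 (truncDomain Ω ρ) (Metric.sphere 0 ρ)
  E_init : E 0 = 0
  H_init : H 0 = 0

end PML

end

/-! In the spherical basis `(BA)⁻¹ = diag{β²/α, α, α}`. Since `α` is nondecreasing and `β` is its
mean, `1 ≤ β ≤ α ≤ 1 + σ₀T` for `r > 0`. So multiplication by `(BA)⁻¹` is `N²` with `N` symmetric,
and both `N` and `N⁻¹` have norm at most `√(1 + σ₀T)`. With `z = (E, H)` and `P = diag(√ε N, √μ N)`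
the problem reads `P² z' = 𝒜 z - (J, 0)`, where `𝒜 (E, H) = (∇ × H, -∇ × E)` on `H₀(curl) ×
H(curl)`. Defined through the trace functional, `H₀(curl)` is exactly the domain of the adjoint of
the curl on `H(curl)` (`mem_HCurl0_iff`). Hence `𝒜` is skew-adjoint for every open set
(`isSkewAdjointGraph_maxwell`), without any regularity of the boundary, and so is `P⁻¹ 𝒜 P⁻¹`.

For existence the equation is differentiated in time. As `J(0) = 0`, the function `w = P z'`
formally solves `w' = P⁻¹ 𝒜 P⁻¹ w + g`, `w(0) = 0`, with `g = -P⁻¹ (∂ₜJ, 0)`. This is read in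
integrated form: `(∫₀ᵗ w, w(t) - ∫₀ᵗ g)` belongs to the graph. `exists_mild` obtains a continuous
`w` with `‖w(t)‖ ≤ ∫₀ᵀ ‖g‖` as a limit of Yosida approximations, whose exponentials are
contractions. Then `z = ∫₀ᵗ P⁻¹ w` is `C¹`, lies in the domain at every time, and has its curls
given by the equation.

The two applications of `P⁻¹` cost one factor `1 + σ₀T`; reading the curls off the equation costs a
factor `N²`, hence the second one. The factor `√T` is Cauchy-Schwarz for the `L¹` norm of `∂ₜJ`.

For uniqueness, the fundamental theorem of calculus in `H¹` writes the difference `z` of two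
solutions as the integral of its weak derivative. Then `U = ∫₀ᵗ z` is a classical solution of `P² U'
= 𝒜 U`, so `‖P U‖` is constant, hence zero. -/

noncomputable section

namespace PML

/-! ### Skew-adjoint operators and their evolution equations -/

section SkewAdjoint

open Filter Topology

variable {H : Type*} [NormedAddCommGroup H] [InnerProductSpace ℝ H]

/-- `G` is the graph of a skew-adjoint operator in the real Hilbert space `H`. -/
structure IsSkewAdjointGraph (G : Submodule ℝ (H × H)) : Prop where
  skew : ∀ p ∈ G, inner ℝ p.1 p.2 = 0
  maximal : ∀ x y : H, (∀ p ∈ G, inner ℝ x p.2 + inner ℝ y p.1 = 0) → (x, y) ∈ G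
  single : ∀ z : H, ((0 : H), z) ∈ G → z = 0

/-- `A` is the Yosida approximation `𝒜 (1 - l 𝒜)⁻¹` of the operator `𝒜` with graph `G`. -/
def IsYosida (G : Submodule ℝ (H × H)) (l : ℝ) (A : H →L[ℝ] H) : Prop :=
  ∀ f, (f + l • A f, A f) ∈ G

namespace IsSkewAdjointGraph

variable {G : Submodule ℝ (H × H)} (hG : IsSkewAdjointGraph G)
include hG

/-- Expand `skew` at `p + q`. Together with `maximal` this makes `G` its own annihilator for the
pairing on the left, which is why `G` is closed. -/
lemma polar {p q : H × H} (hp : p ∈ G) (hq : q ∈ G) :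
    inner ℝ p.1 q.2 + inner ℝ p.2 q.1 = 0 := by
  have h := hG.skew _ (G.add_mem hp hq)
  have h1 := hG.skew _ hp
  have h2 := hG.skew _ hq
  simp only [Prod.fst_add, Prod.snd_add, inner_add_left, inner_add_right] at h
  rw [real_inner_comm q.1 p.2]
  linarith

lemma isClosed : IsClosed (G : Set (H × H)) := by
  have : (G : Set (H × H)) =
      ⋂ q ∈ G, {p : H × H | inner ℝ p.1 q.2 + inner ℝ p.2 q.1 = 0} := by
    ext p
    simp only [SetLike.mem_coe, mem_iInter, mem_ofPred_eq]
    exact ⟨fun hp q hq => hG.polar hp hq, fun h => hG.maximal p.1 p.2 h⟩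
  rw [this]
  exact isClosed_biInter fun q _ => isClosed_eq (by fun_prop) continuous_const

/-- Pythagoras: the two entries of `p` are orthogonal. Both resolvent bounds below are read off from
it. -/
lemma norm_sub_smul_sq {p : H × H} (hp : p ∈ G) (l : ℝ) :
    ‖p.1 - l • p.2‖ ^ 2 = ‖p.1‖ ^ 2 + l ^ 2 * ‖p.2‖ ^ 2 := by
  rw [norm_sub_sq_real, inner_smul_right, hG.skew p hp, norm_smul, mul_pow, Real.norm_eq_abs,
    sq_abs]
  ring

lemma norm_fst_le {p : H × H} (hp : p ∈ G) (l : ℝ) : ‖p.1‖ ≤ ‖p.1 - l • p.2‖ := by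
  refine le_of_sq_le_sq ?_ (norm_nonneg _)
  rw [hG.norm_sub_smul_sq hp l]
  nlinarith [mul_nonneg (sq_nonneg l) (sq_nonneg ‖p.2‖)]

lemma norm_snd_le {p : H × H} (hp : p ∈ G) {l : ℝ} (hl : 0 < l) :
    ‖p.2‖ ≤ l⁻¹ * ‖p.1 - l • p.2‖ := by
  rw [inv_mul_eq_div, le_div_iff₀ hl]
  refine le_of_sq_le_sq ?_ (norm_nonneg _)
  rw [hG.norm_sub_smul_sq hp l]
  nlinarith [sq_nonneg ‖p.1‖]

/-- The range of `1 - l 𝒜` is closed because this map is bounded below on the graph. It is dense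
because a vector `z` orthogonal to it gives `(-l z, z) ∈ G` by `maximal`, and then skewness forces
`z = 0`. -/
lemma exists_resolvent [CompleteSpace H] {l : ℝ} (hl : 0 < l) (f : H) :
    ∃ p ∈ G, p.1 - l • p.2 = f := by
  have : CompleteSpace G := hG.isClosed.completeSpace_coe
  let φ : G →L[ℝ] H :=
    ((ContinuousLinearMap.fst ℝ H H) - l • (ContinuousLinearMap.snd ℝ H H)).comp G.subtypeL
  have hφ : ∀ p : G, φ p = p.1.1 - l • p.1.2 := fun p => rfl
  have hanti : AntilipschitzWith (Real.toNNReal (max 1 l⁻¹)) φ := by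
    refine AddMonoidHomClass.antilipschitz_of_bound φ fun p => ?_
    rw [Real.coe_toNNReal _ (by positivity), hφ]
    have h1 := hG.norm_fst_le p.2 l
    have h2 := hG.norm_snd_le p.2 hl
    refine (max_le (h1.trans ?_) (h2.trans ?_) : max ‖p.1.1‖ ‖p.1.2‖ ≤ _)
    · exact le_mul_of_one_le_left (norm_nonneg _) (le_max_left _ _)
    · exact mul_le_mul_of_nonneg_right (le_max_right _ _) (norm_nonneg _)
  have hcl : IsClosed (LinearMap.range (φ : G →ₗ[ℝ] H) : Set H) := by
    rw [LinearMap.coe_range]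
    exact hanti.isClosed_range φ.uniformContinuous
  have hbot : (LinearMap.range (φ : G →ₗ[ℝ] H))ᗮ = ⊥ := by
    rw [Submodule.eq_bot_iff]
    intro z hz
    have hz' : ∀ p ∈ G, inner ℝ (p.1 - l • p.2) z = 0 := fun p hp =>
      (Submodule.mem_orthogonal _ _).1 hz _ ⟨⟨p, hp⟩, rfl⟩
    have hm : ((-l) • z, z) ∈ G := by
      refine hG.maximal _ _ fun p hp => ?_
      have := hz' p hp
      rw [inner_sub_left, inner_smul_left, real_inner_comm, real_inner_comm z p.2] at this
      simp only [conj_trivial] at this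
      rw [inner_smul_left]
      simp only [conj_trivial]
      linarith
    have := hG.skew _ hm
    simp only [inner_smul_left, conj_trivial, neg_mul, neg_eq_zero, mul_eq_zero, hl.ne',
      inner_self_eq_zero, false_or] at this
    exact this
  have htop : LinearMap.range (φ : G →ₗ[ℝ] H) = ⊤ := by
    have : (LinearMap.range (φ : G →ₗ[ℝ] H)).HasOrthogonalProjection := by
      have : CompleteSpace (LinearMap.range (φ : G →ₗ[ℝ] H)) := hcl.completeSpace_coe
      infer_instance
    exact Submodule.orthogonal_eq_bot_iff.1 hbot
  obtain ⟨p, hp⟩ : f ∈ LinearMap.range (φ : G →ₗ[ℝ] H) := htop ▸ Submodule.mem_top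
  exact ⟨p.1, p.2, hp⟩

lemma resolvent_unique {l : ℝ} {p q : H × H} (hp : p ∈ G) (hq : q ∈ G)
    (h : p.1 - l • p.2 = q.1 - l • q.2) : p = q := by
  have hpq := G.sub_mem hp hq
  have h0 : (p - q).1 - l • (p - q).2 = 0 := by
    simp only [Prod.fst_sub, Prod.snd_sub, smul_sub]
    rw [← sub_eq_zero] at h
    rw [← h]; abel
  have h1 : (p - q).1 = 0 := by
    have := hG.norm_fst_le hpq l
    rw [h0, norm_zero] at this
    exact norm_le_zero_iff.1 this
  have h2 : (p - q).2 = 0 := hG.single _ (by rw [← h1]; exact hpq)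
  exact sub_eq_zero.1 (Prod.ext h1 h2)

lemma exists_yosida [CompleteSpace H] {l : ℝ} (hl : 0 < l) : ∃ A, IsYosida G l A := by
  choose P hP hPf using fun f => hG.exists_resolvent hl f
  have huniq : ∀ f, ∀ q ∈ G, q.1 - l • q.2 = f → P f = q := fun f q hq h =>
    hG.resolvent_unique (hP f) hq (by rw [hPf, h])
  let A₀ : H →ₗ[ℝ] H :=
    { toFun := fun f => (P f).2
      map_add' := fun f g => by
        rw [huniq (f + g) _ (G.add_mem (hP f) (hP g)) (by
          conv_rhs => rw [← hPf f, ← hPf g]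
          simp only [Prod.fst_add, Prod.snd_add, smul_add]; abel)]
        rfl
      map_smul' := fun c f => by
        rw [huniq (c • f) _ (G.smul_mem c (hP f)) (by
          nth_rw 3 [← hPf f]
          simp only [Prod.smul_fst, Prod.smul_snd, smul_sub, smul_comm l c])]
        rfl }
  refine ⟨A₀.mkContinuous l⁻¹ fun f => ?_, fun f => ?_⟩
  · have := hG.norm_snd_le (hP f) hl
    rwa [hPf f] at this
  · have : f + l • (P f).2 = (P f).1 := by
      nth_rw 1 [← hPf f]; abel
    change (f + l • (P f).2, (P f).2) ∈ G
    rw [this]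
    exact hP f

variable {l : ℝ} {A : H →L[ℝ] H} (hA : IsYosida G l A)
include hA

lemma yosida_eq {p : H × H} (hp : p ∈ G) : A (p.1 - l • p.2) = p.2 := by
  have := hG.resolvent_unique (l := l) (hA (p.1 - l • p.2)) hp (by simp)
  exact congrArg Prod.snd this

lemma yosida_dissipative (hl : 0 ≤ l) (f : H) : inner ℝ (A f) f ≤ 0 := by
  have := hG.skew _ (hA f)
  simp only [inner_add_left, inner_smul_left, conj_trivial, real_inner_self_eq_norm_sq] at this
  rw [real_inner_comm]
  nlinarith [mul_nonneg hl (sq_nonneg ‖A f‖)]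

/-- On the domain the resolvent may be moved to the left of `𝒜`: the right side is `(1 - l 𝒜)⁻¹ y`.
So `A x` differs from `𝒜 x` only by `l A y`. -/
lemma yosida_apply_dom {x y : H} (h : (x, y) ∈ G) : A x = y + l • A y := by
  have h1 : (x + l • (y + l • A y), y + l • A y) ∈ G := by
    have := G.add_mem h (G.smul_mem l (hA y))
    simpa using this
  have := hG.yosida_eq hA h1
  simpa using this

lemma norm_resolvent_le (y : H) : ‖y + l • A y‖ ≤ ‖y‖ := by
  have := hG.norm_fst_le (hA y) l
  simpa using this

lemma norm_yosida_dom_le {x y : H} (h : (x, y) ∈ G) : ‖A x‖ ≤ ‖y‖ := by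
  rw [hG.yosida_apply_dom hA h]
  exact hG.norm_resolvent_le hA y

lemma yosida_mem (hl : 0 < l) {x y : H} (h : (x, y) ∈ G) : (A x, A y) ∈ G := by
  have h1 := G.smul_mem l⁻¹ (G.sub_mem (hA x) h)
  rw [hG.yosida_apply_dom hA h] at *
  simpa [hl.ne', smul_smul] using h1

/-- `B` maps the graph into itself, so applying it to `(f + l A f, A f)` gives the pair that
determines `A (B f)`. -/
lemma yosida_commute {ν : ℝ} {B : H →L[ℝ] H} (hν : 0 < ν) (hB : IsYosida G ν B) :
    Commute A B := by
  ext f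
  have h := hG.yosida_mem hB hν (hA f)
  have := hG.yosida_eq hA h
  simpa using this

end IsSkewAdjointGraph

end SkewAdjoint

/-! ### Exponentials of bounded dissipative operators and Duhamel's formula. -/

section Duhamel

open Filter Topology NormedSpace

variable {H : Type*} [NormedAddCommGroup H] [InnerProductSpace ℝ H] [CompleteSpace H]

lemma hasDerivAt_exp_smul_apply (A : H →L[ℝ] H) (x : H) (t : ℝ) :
    HasDerivAt (fun s : ℝ => exp (s • A) x) (A (exp (t • A) x)) t := by
  have := (hasDerivAt_exp_smul_const' A t).clm_apply (hasDerivAt_const t x)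
  simpa using this

lemma continuous_exp_smul (A : H →L[ℝ] H) : Continuous fun s : ℝ => exp (s • A) :=
  continuous_iff_continuousAt.2 fun t => (hasDerivAt_exp_smul_const' A t).continuousAt

lemma exp_smul_mul_exp_smul (A : H →L[ℝ] H) (s t : ℝ) :
    exp (s • A) * exp (t • A) = exp ((s + t) • A) := by
  rw [add_smul]
  let _ : NormedAlgebra ℚ (H →L[ℝ] H) := NormedAlgebra.restrictScalars ℚ ℝ _
  exact (exp_add_of_commute (((Commute.refl A).smul_left s).smul_right t)).symm

lemma norm_exp_smul_apply_le {A : H →L[ℝ] H} (hA : ∀ f, inner ℝ (A f) f ≤ 0) {t : ℝ}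
    (ht : 0 ≤ t) (x : H) : ‖exp (t • A) x‖ ≤ ‖x‖ := by
  have hd : ∀ s, HasDerivAt (fun s : ℝ => ‖exp (s • A) x‖ ^ 2)
      (2 * inner ℝ (exp (s • A) x) (A (exp (s • A) x))) s := fun s =>
    (hasDerivAt_exp_smul_apply A x s).norm_sq
  have hanti : Antitone fun s : ℝ => ‖exp (s • A) x‖ ^ 2 :=
    antitone_of_deriv_nonpos (fun s => (hd s).differentiableAt) fun s => by
      rw [(hd s).deriv, real_inner_comm]
      linarith [hA (exp (s • A) x)]
  have := hanti ht
  simp only [zero_smul, exp_zero, one_apply_eq_self] at this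
  exact le_of_sq_le_sq this (norm_nonneg _)

/-- Interpolate by `s ↦ exp((t - s)B) exp(sA) x`. Because `A` and `B` commute, its derivative is two
contractions applied to `A x - B x`. -/
lemma norm_exp_smul_sub_le {A B : H →L[ℝ] H} (hA : ∀ f, inner ℝ (A f) f ≤ 0)
    (hB : ∀ f, inner ℝ (B f) f ≤ 0) (hAB : Commute A B) {t : ℝ} (ht : 0 ≤ t) (x : H) :
    ‖exp (t • A) x - exp (t • B) x‖ ≤ ‖A x - B x‖ * t := by
  let φ : ℝ → H := fun s => exp ((t - s) • B) (exp (s • A) x)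
  have hd : ∀ s, HasDerivAt φ (exp ((t - s) • B) (exp (s • A) (A x - B x))) s := by
    intro s
    have h1 : HasDerivAt (fun s : ℝ => exp ((t - s) • B)) (-(exp ((t - s) • B) * B)) s := by
      have := (hasDerivAt_exp_smul_const B (t - s)).scomp s ((hasDerivAt_id s).const_sub t)
      simpa [Function.comp_def] using this
    have h2 := h1.clm_apply (hasDerivAt_exp_smul_apply A x s)
    convert h2 using 1
    have hcA : ∀ y, exp (s • A) (A y) = A (exp (s • A) y) := fun y =>
      congrArg (fun C : H →L[ℝ] H => C y)
        (((Commute.refl A).smul_right s).exp_right.symm.eq)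
    have hcB : ∀ y, exp (s • A) (B y) = B (exp (s • A) y) := fun y =>
      congrArg (fun C : H →L[ℝ] H => C y)
        ((hAB.symm.smul_right s).exp_right.symm.eq)
    simp [hcA, hcB, map_sub]
    abel
  have hbound : ∀ s ∈ Ico 0 t, ‖exp ((t - s) • B) (exp (s • A) (A x - B x))‖ ≤ ‖A x - B x‖ :=
    fun s hs => (norm_exp_smul_apply_le hB (by linarith [hs.2]) _).trans
      (norm_exp_smul_apply_le hA hs.1 _)
  have := norm_image_sub_le_of_norm_deriv_le_segment' (fun s _ => (hd s).hasDerivWithinAt) hbound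
    t (right_mem_Icc.2 ht)
  simpa [φ] using this

/-- The solution of `w' = A w + g`, `w(0) = 0`. -/
def duhamel (A : H →L[ℝ] H) (g : ℝ → H) (t : ℝ) : H :=
  exp (t • A) (∫ s in 0..t, exp ((-s) • A) (g s))

variable {A : H →L[ℝ] H} {g : ℝ → H}

lemma duhamel_eq_integral (hg : Continuous g) (t : ℝ) :
    duhamel A g t = ∫ s in 0..t, exp ((t - s) • A) (g s) := by
  have hc : Continuous fun s : ℝ => exp ((-s) • A) (g s) :=
    ((continuous_exp_smul A).comp continuous_neg).clm_apply hg
  rw [duhamel, ← ContinuousLinearMap.intervalIntegral_comp_comm _ (hc.intervalIntegrable _ _)]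
  refine intervalIntegral.integral_congr fun s _ => ?_
  rw [sub_eq_add_neg, ← exp_smul_mul_exp_smul]
  rfl

lemma hasDerivAt_duhamel (hg : Continuous g) (t : ℝ) :
    HasDerivAt (duhamel A g) (A (duhamel A g t) + g t) t := by
  have hc : Continuous fun s : ℝ => exp ((-s) • A) (g s) :=
    ((continuous_exp_smul A).comp continuous_neg).clm_apply hg
  have h := (hasDerivAt_exp_smul_const' A t).clm_apply
    (intervalIntegral.integral_hasDerivAt_right (hc.intervalIntegrable 0 t)
      hc.stronglyMeasurable.stronglyMeasurableAtFilter hc.continuousAt)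
  have : exp (t • A) (exp ((-t) • A) (g t)) = g t := by
    rw [← mul_apply_eq_comp, exp_smul_mul_exp_smul]
    simp
  rw [this] at h
  exact h

lemma continuous_duhamel (hg : Continuous g) : Continuous (duhamel A g) :=
  continuous_iff_continuousAt.2 fun t => (hasDerivAt_duhamel hg t).continuousAt

/-- The operator acts on the time integral here. In this form the equation passes to the limit as
soon as the solutions themselves converge. -/
lemma duhamel_eq (hg : Continuous g) (t : ℝ) :
    duhamel A g t = A (∫ s in 0..t, duhamel A g s) + ∫ s in 0..t, g s := by
  have hc := continuous_duhamel (A := A) hg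
  have h := intervalIntegral.integral_eq_sub_of_hasDerivAt
    (fun s _ => hasDerivAt_duhamel (A := A) hg s)
    (((A.continuous.comp hc).add hg).intervalIntegrable 0 t)
  have h0 : duhamel A g 0 = 0 := by simp [duhamel]
  rw [h0, sub_zero, intervalIntegral.integral_add (f := fun s => A (duhamel A g s))
    ((A.continuous.comp hc).intervalIntegrable _ _)
    (hg.intervalIntegrable _ _),
    ContinuousLinearMap.intervalIntegral_comp_comm _ (hc.intervalIntegrable _ _)] at h
  exact h.symm

lemma norm_duhamel_sub_le (hA : ∀ f, inner ℝ (A f) f ≤ 0) {g₁ g₂ : ℝ → H} (h₁ : Continuous g₁)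
    (h₂ : Continuous g₂) {t : ℝ} (ht : 0 ≤ t) :
    ‖duhamel A g₁ t - duhamel A g₂ t‖ ≤ ∫ s in 0..t, ‖g₁ s - g₂ s‖ := by
  have hc : ∀ g : ℝ → H, Continuous g → Continuous fun s : ℝ => exp ((t - s) • A) (g s) :=
    fun g hg => ((continuous_exp_smul A).comp (continuous_const.sub continuous_id)).clm_apply hg
  rw [duhamel_eq_integral h₁, duhamel_eq_integral h₂, ← intervalIntegral.integral_sub
    ((hc _ h₁).intervalIntegrable _ _) ((hc _ h₂).intervalIntegrable _ _)]
  refine intervalIntegral.norm_integral_le_of_norm_le ht ?_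
    ((h₁.sub h₂).norm.intervalIntegrable _ _)
  refine ae_of_all _ fun s hs => ?_
  rw [← map_sub]
  exact norm_exp_smul_apply_le hA (by linarith [hs.2]) _

end Duhamel

/-! ### Uniform limits in time and approximation in `L¹(0,T)`. -/

section Limit

open Filter Topology

variable {X : Type*} [NormedAddCommGroup X]

/-- A uniformly Cauchy sequence of continuous functions on `[0,T]` has a continuous limit. -/
lemma exists_continuous_limit [CompleteSpace X] {T : ℝ} (hT : 0 ≤ T)
    {w : ℕ → ℝ → X} (hw : ∀ n, Continuous (w n))
    (hC : ∀ e > 0, ∃ N, ∀ n ≥ N, ∀ m ≥ N, ∀ t ∈ Icc 0 T, ‖w n t - w m t‖ ≤ e) :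
    ∃ W : ℝ → X, Continuous W ∧ TendstoUniformlyOn w W atTop (Icc 0 T) := by
  have hu : UniformCauchySeqOn w atTop (Icc 0 T) := by
    rw [Metric.uniformCauchySeqOn_iff]
    intro e he
    obtain ⟨N, hN⟩ := hC (e / 2) (half_pos he)
    refine ⟨N, fun m hm n hn t ht => ?_⟩
    rw [dist_eq_norm]
    exact (hN m hm n hn t ht).trans_lt (half_lt_self he)
  have hlim : ∀ t ∈ Icc 0 T, ∃ y, Tendsto (fun n => w n t) atTop (𝓝 y) := fun t ht =>
    cauchySeq_tendsto_of_complete (hu.cauchySeq ht)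
  choose! W hW using hlim
  have hunif := hu.tendstoUniformlyOn_of_tendsto hW
  have hcont : ContinuousOn W (Icc 0 T) :=
    hunif.continuousOn (Eventually.of_forall fun n => (hw n).continuousOn).frequently
  -- Constant extension beyond `[0,T]` gives continuity on all of `ℝ`, so later integrals and
  -- derivatives need no endpoint discussion.
  refine ⟨IccExtend hT ((Icc 0 T).domRestrict W), ?_, ?_⟩
  · exact (continuousOn_iff_continuous_domRestrict.1 hcont).Icc_extend'
  · refine hunif.congr_right fun t ht => ?_
    rw [IccExtend_of_mem _ _ ht]
    rfl

lemma tendsto_integral_of_tendstoUniformlyOn [NormedSpace ℝ X] {T : ℝ} {w : ℕ → ℝ → X} {W : ℝ → X}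
    (hw : ∀ n, Continuous (w n)) (hW : Continuous W)
    (h : TendstoUniformlyOn w W atTop (Icc 0 T)) {t : ℝ} (ht : t ∈ Icc 0 T) :
    Tendsto (fun n => ∫ s in 0..t, w n s) atTop (𝓝 (∫ s in 0..t, W s)) := by
  rw [Metric.tendsto_atTop]
  intro e he
  rw [Metric.tendstoUniformlyOn_iff] at h
  have hpos : 0 < e / (t + 1) := div_pos he (by linarith [ht.1])
  obtain ⟨N, hN⟩ := eventually_atTop.1 (h _ hpos)
  refine ⟨N, fun n hn => ?_⟩
  rw [dist_eq_norm, ← intervalIntegral.integral_sub ((hw n).intervalIntegrable _ _)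
    (hW.intervalIntegrable _ _)]
  have : ∀ s ∈ uIoc 0 t, ‖w n s - W s‖ ≤ e / (t + 1) := by
    intro s hs
    rw [uIoc_of_le ht.1] at hs
    have := hN n hn s ⟨hs.1.le, hs.2.trans ht.2⟩
    rw [dist_comm, dist_eq_norm] at this
    exact this.le
  refine (intervalIntegral.norm_integral_le_of_norm_le_const this).trans_lt ?_
  rw [sub_zero, abs_of_nonneg ht.1, div_mul_eq_mul_div, div_lt_iff₀ (by linarith [ht.1])]
  nlinarith

/-- Continuous functions are dense in `L¹(0,T)`. -/
lemma exists_continuous_integral_norm_sub_le [NormedSpace ℝ X] {g : ℝ → X} {T : ℝ} (hT : 0 ≤ T)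
    (hg : IntervalIntegrable g volume 0 T) {e : ℝ} (he : 0 < e) :
    ∃ γ : ℝ → X, Continuous γ ∧ ∀ t ∈ Icc 0 T, ∫ s in 0..t, ‖g s - γ s‖ ≤ e := by
  have hgi : Integrable ((Ioc 0 T).indicator g) :=
    (integrable_indicator_iff measurableSet_Ioc).2
      ((intervalIntegrable_iff_integrableOn_Ioc_of_le hT).1 hg)
  obtain ⟨γ, -, hγ, hγc, hγi⟩ := hgi.exists_hasCompactSupport_integral_sub_le he
  refine ⟨γ, hγc, fun t ht => le_trans ?_ hγ⟩
  rw [intervalIntegral.integral_of_le ht.1]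
  have : ∀ s ∈ Ioc 0 t, ‖g s - γ s‖ = ‖(Ioc 0 T).indicator g s - γ s‖ := fun s hs => by
    have hsT : s ∈ Ioc 0 T := ⟨hs.1, hs.2.trans ht.2⟩
    rw [indicator_of_mem hsT]
  rw [setIntegral_congr_fun measurableSet_Ioc this]
  exact setIntegral_le_integral (hgi.sub hγi).norm (ae_of_all _ fun s => norm_nonneg _)

end Limit

/-! ### Mild solutions through Yosida approximation. -/

section Evolution

open Filter Topology

variable {H : Type*} [NormedAddCommGroup H] [InnerProductSpace ℝ H] [CompleteSpace H]
  {G : Submodule ℝ (H × H)}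

/-- The parameters `1 / (n + 1)` of the Yosida approximations. -/
def yosidaParam (n : ℕ) : ℝ := 1 / ((n : ℝ) + 1)

lemma yosidaParam_pos (n : ℕ) : 0 < yosidaParam n := Nat.one_div_pos_of_nat

lemma tendsto_yosidaParam : Tendsto yosidaParam atTop (𝓝 0) :=
  tendsto_one_div_add_atTop_nhds_zero_nat

namespace IsSkewAdjointGraph

variable (hG : IsSkewAdjointGraph G)
include hG

/-- If `z` is orthogonal to the domain, then `(0, z) ∈ G` by `maximal`, so single-valuedness gives
`z = 0`. -/
lemma dense_domain : Dense (G.map (LinearMap.fst ℝ H H) : Set H) := by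
  rw [Submodule.dense_iff_topologicalClosure_eq_top, Submodule.topologicalClosure_eq_top_iff,
    Submodule.eq_bot_iff]
  intro z hz
  refine hG.single z (hG.maximal 0 z fun p hp => ?_)
  rw [inner_zero_left, zero_add, real_inner_comm]
  exact (Submodule.mem_orthogonal _ _).1 hz p.1 ⟨p, hp, rfl⟩

variable {A : ℕ → H →L[ℝ] H} (hA : ∀ n, IsYosida G (yosidaParam n) (A n))
include hA

omit [CompleteSpace H] in
lemma norm_smul_yosida_le (n : ℕ) (z : H) : ‖yosidaParam n • A n z‖ ≤ 2 * ‖z‖ := by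
  have h1 := hG.norm_resolvent_le (hA n) z
  have h2 := norm_sub_le (z + yosidaParam n • A n z) z
  rw [add_sub_cancel_left] at h2
  linarith

/-- On the domain `‖A n x‖` is bounded in `n`, so the factor `yosidaParam n` wins; density and the
uniform bound `2 ‖z‖` cover the rest. -/
lemma tendsto_smul_yosida (z : H) :
    Tendsto (fun n => yosidaParam n • A n z) atTop (𝓝 0) := by
  rw [Metric.tendsto_atTop]
  intro e he
  obtain ⟨x, hx, ⟨p, hp, rfl⟩⟩ := Metric.dense_iff.1 hG.dense_domain z (e / 4) (by positivity)
  simp only [LinearMap.fst_apply, Metric.mem_ball, dist_eq_norm, SetLike.mem_coe] at hx hp ⊢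
  have hlim : Tendsto (fun n => yosidaParam n * ‖p.2‖) atTop (𝓝 0) := by
    simpa using tendsto_yosidaParam.mul_const ‖p.2‖
  obtain ⟨N, hN⟩ := eventually_atTop.1 (hlim.eventually_lt_const (show 0 < e / 4 by positivity))
  refine ⟨N, fun n hn => ?_⟩
  have h1 := hG.norm_smul_yosida_le hA n (p.1 - z)
  have h2 : ‖yosidaParam n • A n p.1‖ ≤ yosidaParam n * ‖p.2‖ := by
    rw [norm_smul, Real.norm_of_nonneg (yosidaParam_pos n).le]
    exact mul_le_mul_of_nonneg_left (hG.norm_yosida_dom_le (hA n) hp) (yosidaParam_pos n).le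
  have h3 := norm_sub_le (yosidaParam n • A n p.1) (yosidaParam n • A n (p.1 - z))
  rw [← smul_sub, ← map_sub, sub_sub_cancel] at h3
  rw [sub_zero]
  linarith [hN n hn]

lemma tendsto_integral_smul_yosida {g : ℝ → H} (hg : Continuous g) (T : ℝ) :
    Tendsto (fun n => ∫ s in 0..T, ‖yosidaParam n • A n (g s)‖) atTop (𝓝 0) := by
  have := intervalIntegral.tendsto_integral_filter_of_dominated_convergence
    (μ := volume) (a := 0) (b := T) (l := atTop)
    (F := fun n s => ‖yosidaParam n • A n (g s)‖) (f := fun _ => (0 : ℝ))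
    (fun s => 2 * ‖g s‖)
    (Eventually.of_forall fun n =>
      (((A n).continuous.comp hg).const_smul _).norm.aestronglyMeasurable)
    (Eventually.of_forall fun n => ae_of_all _ fun s _ => by
      rw [norm_norm]; exact hG.norm_smul_yosida_le hA n (g s))
    ((continuous_const.mul hg.norm).intervalIntegrable _ _)
    (ae_of_all _ fun s _ => by simpa using (hG.tendsto_smul_yosida hA (g s)).norm)
  simpa using this

/-- Replace `g` by `h = (1 - l 𝒜)⁻¹ g` with a fixed small `l`. The error is small uniformly in `n`
by contractivity, while `h` takes values in the domain with continuous image `y = 𝒜 h`. For such a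
source the exponentials differ by at most `T` times the size of `A n h - A m h`, that is, of a
difference of terms `yosidaParam n • A n y`, which tend to zero in `L¹`. -/
lemma duhamel_yosida_cauchy {g : ℝ → H} (hg : Continuous g) {T : ℝ} (hT : 0 ≤ T) {e : ℝ}
    (he : 0 < e) : ∃ N, ∀ n ≥ N, ∀ m ≥ N, ∀ t ∈ Icc 0 T,
      ‖duhamel (A n) g t - duhamel (A m) g t‖ ≤ e := by
  have hdis : ∀ n f, inner ℝ (A n f) f ≤ 0 := fun n =>
    hG.yosida_dissipative (hA n) (yosidaParam_pos n).le
  obtain ⟨k, hk⟩ := ((hG.tendsto_integral_smul_yosida hA hg T).eventually_lt_const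
    (show 0 < e / 4 by positivity)).exists
  let y : ℝ → H := fun s => A k (g s)
  let h : ℝ → H := fun s => g s + yosidaParam k • y s
  have hy : Continuous y := (A k).continuous.comp hg
  have hh : Continuous h := hg.add (hy.const_smul _)
  have hGh : ∀ s, (h s, y s) ∈ G := fun s => hA k (g s)
  have hmono : ∀ f : ℝ → H, Continuous f → ∀ t ∈ Icc 0 T,
      ∫ s in 0..t, ‖f s‖ ≤ ∫ s in 0..T, ‖f s‖ := fun f hf t ht =>
    intervalIntegral.integral_mono_interval le_rfl ht.1 ht.2 (ae_of_all _ fun s => norm_nonneg _)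
      (hf.norm.intervalIntegrable _ _)
  have hgh : ∀ n, ∀ t ∈ Icc 0 T, ‖duhamel (A n) h t - duhamel (A n) g t‖ ≤ e / 4 := by
    intro n t ht
    refine (norm_duhamel_sub_le (hdis n) hh hg ht.1).trans ?_
    refine (hmono _ (hh.sub hg) t ht).trans ?_
    simpa [h, y] using hk.le
  -- Two such terms, each multiplied by `T`, must stay below `e / 2`; writing `T + 1` allows `T =
  -- 0`.
  obtain ⟨N, hN⟩ := eventually_atTop.1
    ((hG.tendsto_integral_smul_yosida hA hy T).eventually_lt_const
    (show 0 < e / (4 * (T + 1)) by positivity))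
  refine ⟨N, fun n hn m hm t ht => ?_⟩
  have hmid : ‖duhamel (A n) h t - duhamel (A m) h t‖ ≤ e / 2 := by
    have hc : ∀ n, Continuous fun s : ℝ => NormedSpace.exp ((t - s) • A n) (h s) := fun n =>
      ((continuous_exp_smul (A n)).comp (continuous_const.sub continuous_id)).clm_apply hh
    have hcl : ∀ n, Continuous fun s => ‖yosidaParam n • A n (y s)‖ := fun n =>
      (((A n).continuous.comp hy).const_smul _).norm
    rw [duhamel_eq_integral hh, duhamel_eq_integral hh, ← intervalIntegral.integral_sub
      ((hc n).intervalIntegrable _ _) ((hc m).intervalIntegrable _ _)]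
    have hb : ‖∫ s in 0..t, (NormedSpace.exp ((t - s) • A n) (h s)
        - NormedSpace.exp ((t - s) • A m) (h s))‖ ≤
        ∫ s in 0..t, T * (‖yosidaParam n • A n (y s)‖ + ‖yosidaParam m • A m (y s)‖) := by
      refine intervalIntegral.norm_integral_le_of_norm_le ht.1 (ae_of_all _ fun s hs => ?_)
        ((continuous_const.mul ((hcl n).add (hcl m))).intervalIntegrable _ _)
      have hts : 0 ≤ t - s := by linarith [hs.2]
      refine (norm_exp_smul_sub_le (hdis n) (hdis m)
        (hG.yosida_commute (hA n) (yosidaParam_pos m) (hA m)) hts _).trans ?_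
      rw [hG.yosida_apply_dom (hA n) (hGh s), hG.yosida_apply_dom (hA m) (hGh s),
        add_sub_add_left_eq_sub, mul_comm T]
      exact mul_le_mul (norm_sub_le _ _) (by linarith [hs.1, ht.2]) hts (by positivity)
    refine hb.trans ?_
    rw [intervalIntegral.integral_const_mul, intervalIntegral.integral_add
      ((hcl n).intervalIntegrable _ _) ((hcl m).intervalIntegrable _ _)]
    have h1 := (hmono _ (((A n).continuous.comp hy).const_smul (yosidaParam n)) t ht).trans
      (hN n hn).le
    have h2 := (hmono _ (((A m).continuous.comp hy).const_smul (yosidaParam m)) t ht).trans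
      (hN m hm).le
    calc _ ≤ T * (e / (4 * (T + 1)) + e / (4 * (T + 1))) :=
          mul_le_mul_of_nonneg_left (add_le_add h1 h2) hT
      _ = (T / (T + 1)) * (e / 2) := by field_simp; ring
      _ ≤ 1 * (e / 2) := by
          refine mul_le_mul_of_nonneg_right ?_ (by positivity)
          rw [div_le_one (by positivity)]; linarith
      _ = e / 2 := one_mul _
  have h1 := hgh n t ht
  have h2 := hgh m t ht
  have : duhamel (A n) g t - duhamel (A m) g t =
      (duhamel (A n) h t - duhamel (A m) h t) - (duhamel (A n) h t - duhamel (A n) g t)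
        + (duhamel (A m) h t - duhamel (A m) g t) := by abel
  rw [this]
  have h3 := norm_add_le ((duhamel (A n) h t - duhamel (A m) h t) -
    (duhamel (A n) h t - duhamel (A n) g t)) (duhamel (A m) h t - duhamel (A m) g t)
  have h4 := norm_sub_le (duhamel (A n) h t - duhamel (A m) h t)
    (duhamel (A n) h t - duhamel (A n) g t)
  linarith

/-- With `I` the integral of the `n`-th approximation, `(I + l A I, A I)` lies in `G`, where `l =
yosidaParam n` and `A = A n`. Here `A I` converges by `duhamel_eq`, so `l A I → 0`, and closedness
of `G` gives the claim. -/
lemma exists_mild_of_continuous {g : ℝ → H} (hg : Continuous g) {T : ℝ} (hT : 0 ≤ T) :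
    ∃ w : ℝ → H, Continuous w ∧
      TendstoUniformlyOn (fun n => duhamel (A n) g) w atTop (Icc 0 T) ∧
      ∀ t ∈ Icc 0 T, (∫ s in 0..t, w s, w t - ∫ s in 0..t, g s) ∈ G := by
  obtain ⟨w, hw, hlim⟩ := exists_continuous_limit hT
    (fun n => continuous_duhamel (A := A n) hg)
    (fun e he => hG.duhamel_yosida_cauchy hA hg hT he)
  refine ⟨w, hw, hlim, fun t ht => ?_⟩
  have h1 := tendsto_integral_of_tendstoUniformlyOn
    (fun n => continuous_duhamel (A := A n) hg) hw hlim ht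
  have h2 : Tendsto (fun n => A n (∫ s in 0..t, duhamel (A n) g s)) atTop
      (𝓝 (w t - ∫ s in 0..t, g s)) := by
    refine ((hlim.tendsto_at ht).sub_const _).congr fun n => ?_
    rw [duhamel_eq hg t, add_sub_cancel_right]
  have h3 : Tendsto (fun n => (∫ s in 0..t, duhamel (A n) g s)
      + yosidaParam n • A n (∫ s in 0..t, duhamel (A n) g s)) atTop (𝓝 (∫ s in 0..t, w s)) := by
    simpa using h1.add (tendsto_yosidaParam.smul h2)
  exact hG.isClosed.mem_of_tendsto (h3.prodMk_nhds h2) (Eventually.of_forall fun n => hA n _)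

omit hA in
/-- The integrated form of `u' = 𝒜 u + ∫ g`, `u(0) = 0`, with `w = u'`, has a solution. -/
theorem exists_mild {g : ℝ → H} {T : ℝ} (hT : 0 ≤ T) (hg : IntervalIntegrable g volume 0 T) :
    ∃ w : ℝ → H, Continuous w ∧
      (∀ t ∈ Icc 0 T, (∫ s in 0..t, w s, w t - ∫ s in 0..t, g s) ∈ G) ∧
      ∀ t ∈ Icc 0 T, ‖w t‖ ≤ ∫ s in 0..T, ‖g s‖ := by
  choose A hA using fun n => hG.exists_yosida (yosidaParam_pos n)
  have hdis : ∀ n f, inner ℝ (A n f) f ≤ 0 := fun n =>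
    hG.yosida_dissipative (hA n) (yosidaParam_pos n).le
  choose γ hγc hdist using fun k => exists_continuous_integral_norm_sub_le hT hg
    (yosidaParam_pos k)
  have hgt : ∀ t ∈ Icc 0 T, IntervalIntegrable g volume 0 t := fun t ht =>
    hg.mono_set (by rw [uIcc_of_le ht.1, uIcc_of_le hT]; exact Icc_subset_Icc_right ht.2)
  have hint : ∀ k t, IntervalIntegrable (γ k) volume 0 t := fun k t =>
    (hγc k).intervalIntegrable _ _
  choose w hw hlim hmem using fun k => hG.exists_mild_of_continuous hA (hγc k) hT
  -- The Duhamel map is a contraction from `L¹` to the sup norm, uniformly in the Yosida index, so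
  -- `L¹` convergence of the sources makes the mild solutions uniformly Cauchy.
  obtain ⟨W, hW, hWlim⟩ := exists_continuous_limit hT hw fun e he => by
    obtain ⟨N, hN⟩ := eventually_atTop.1
      (tendsto_yosidaParam.eventually_lt_const (half_pos he))
    refine ⟨N, fun j hj k hk t ht => ?_⟩
    refine le_of_tendsto (((hlim j).tendsto_at ht).sub ((hlim k).tendsto_at ht)).norm
      (Eventually.of_forall fun n => ?_)
    refine (norm_duhamel_sub_le (hdis n) (hγc j) (hγc k) ht.1).trans ?_
    have h1 : ∫ s in 0..t, ‖γ j s - γ k s‖ ≤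
        ∫ s in 0..t, (‖g s - γ j s‖ + ‖g s - γ k s‖) := by
      refine intervalIntegral.integral_mono_on ht.1 ((hint j t).sub (hint k t)).norm
        (((hgt t ht).sub (hint j t)).norm.add ((hgt t ht).sub (hint k t)).norm) fun s _ => ?_
      have := norm_sub_le (g s - γ k s) (g s - γ j s)
      rw [sub_sub_sub_cancel_left] at this
      linarith
    rw [intervalIntegral.integral_add ((hgt t ht).sub (hint j t)).norm
      ((hgt t ht).sub (hint k t)).norm] at h1
    linarith [hdist j t ht, hdist k t ht, hN j hj, hN k hk]
  refine ⟨W, hW, fun t ht => ?_, fun t ht => ?_⟩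
  · have h1 := tendsto_integral_of_tendstoUniformlyOn hw hW hWlim ht
    have h2 : Tendsto (fun k => ∫ s in 0..t, γ k s) atTop (𝓝 (∫ s in 0..t, g s)) := by
      rw [tendsto_iff_norm_sub_tendsto_zero]
      refine squeeze_zero (fun _ => norm_nonneg _) (fun k => ?_) tendsto_yosidaParam
      rw [← intervalIntegral.integral_sub (hint k t) (hgt t ht)]
      refine (intervalIntegral.norm_integral_le_integral_norm ht.1).trans ?_
      simpa only [norm_sub_rev] using hdist k t ht
    exact hG.isClosed.mem_of_tendsto (h1.prodMk_nhds ((hWlim.tendsto_at ht).sub h2))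
      (Eventually.of_forall fun k => hmem k t ht)
  · have h1 : ∀ k, ‖w k t‖ ≤ (∫ s in 0..T, ‖g s‖) + yosidaParam k := by
      intro k
      refine le_of_tendsto ((hlim k).tendsto_at ht).norm (Eventually.of_forall fun n => ?_)
      -- The norm bound is the same contraction estimate against the zero source.
      have := norm_duhamel_sub_le (hdis n) (hγc k) (continuous_const (y := (0 : H))) ht.1
      have h0 : duhamel (A n) (fun _ => (0 : H)) t = 0 := by simp [duhamel]
      rw [h0, sub_zero] at this
      simp only [sub_zero] at this
      refine this.trans ?_
      have h2 : ∫ s in 0..t, ‖γ k s‖ ≤ ∫ s in 0..t, (‖g s‖ + ‖g s - γ k s‖) := by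
        refine intervalIntegral.integral_mono_on ht.1 (hint k t).norm
          ((hgt t ht).norm.add ((hgt t ht).sub (hint k t)).norm) fun s _ => ?_
        have := norm_sub_le (g s) (g s - γ k s)
        rwa [sub_sub_cancel] at this
      rw [intervalIntegral.integral_add (hgt t ht).norm ((hgt t ht).sub (hint k t)).norm] at h2
      have h3 : ∫ s in 0..t, ‖g s‖ ≤ ∫ s in 0..T, ‖g s‖ :=
        intervalIntegral.integral_mono_interval le_rfl ht.1 ht.2
          (ae_of_all _ fun s => norm_nonneg _) hg.norm
      linarith [hdist k t ht]
    have h2 : Tendsto (fun k => (∫ s in 0..T, ‖g s‖) + yosidaParam k) atTop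
        (𝓝 ((∫ s in 0..T, ‖g s‖) + 0)) := tendsto_const_nhds.add tendsto_yosidaParam
    rw [add_zero] at h2
    exact le_of_tendsto_of_tendsto (hWlim.tendsto_at ht).norm h2 (Eventually.of_forall h1)

end IsSkewAdjointGraph

omit [CompleteSpace H] in
/-- Uniqueness for `V' = 𝒜 V`, `V(0) = 0`. -/
lemma eq_zero_of_hasDerivAt_of_skew {V V' : ℝ → H} {T : ℝ}
    (hd : ∀ t, HasDerivAt V (V' t) t) (h0 : V 0 = 0)
    (hs : ∀ t ∈ Icc 0 T, inner ℝ (V t) (V' t) = 0) : ∀ t ∈ Icc 0 T, V t = 0 := by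
  intro t ht
  have hc : ContinuousOn (fun s => ‖V s‖ ^ 2) (Icc 0 T) := fun s _ =>
    (hd s).norm_sq.continuousAt.continuousWithinAt
  have := constant_of_has_deriv_right_zero hc (fun s hs' => by
    have h := (hd s).norm_sq
    rw [hs s (Ico_subset_Icc_self hs'), mul_zero] at h
    exact h.hasDerivWithinAt) t ht
  simpa [h0] using this

end Evolution

/-! ### Weak time derivatives and `H¹(0,T;X)`. -/

section Time

open Filter Topology

variable {X : Type*} [NormedAddCommGroup X] [NormedSpace ℝ X]

omit [NormedSpace ℝ X] in
lemma memLp_Ioo_of_continuousOn {T : ℝ} {u : ℝ → X} (hu : ContinuousOn u (Icc 0 T)) :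
    MemLp u 2 (volume.restrict (Ioo 0 T)) := by
  obtain ⟨C, hC⟩ := isCompact_Icc.exists_bound_of_continuousOn hu
  exact MemLp.of_bound ((hu.mono Ioo_subset_Icc_self).aestronglyMeasurable measurableSet_Ioo) C
    ((ae_restrict_iff' measurableSet_Ioo).2
      (ae_of_all _ fun t ht => hC t (Ioo_subset_Icc_self ht)))

lemma integral_Ioo_eq_interval {T : ℝ} (hT : 0 ≤ T) (f : ℝ → X) :
    ∫ t in Ioo 0 T, f t = ∫ t in 0..T, f t := by
  rw [intervalIntegral.integral_of_le hT, integral_Ioc_eq_integral_Ioo]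

lemma eq_zero_of_tsupport_subset_Ioo {T : ℝ} {φ : ℝ → ℝ} (h : tsupport φ ⊆ Ioo 0 T) :
    φ 0 = 0 ∧ φ T = 0 :=
  ⟨image_eq_zero_of_notMem_tsupport fun h' => (h h').1.false,
    image_eq_zero_of_notMem_tsupport fun h' => (h h').2.false⟩

omit [NormedSpace ℝ X] in
lemma intervalIntegrable_of_memLp {T : ℝ} (hT : 0 ≤ T) {v : ℝ → X}
    (hv : MemLp v 2 (volume.restrict (Ioo 0 T))) : IntervalIntegrable v volume 0 T := by
  rw [intervalIntegrable_iff_integrableOn_Ioo_of_le hT]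
  exact hv.integrable (by norm_num)

variable [CompleteSpace X]

lemma integral_deriv_smul_eq_of_hasDerivAt {T : ℝ} {u u' : ℝ → X}
    (hu : ∀ t, HasDerivAt u (u' t) t) (hu' : Continuous u') {φ : ℝ → ℝ} (hφ : ContDiff ℝ ∞ φ)
    (hs : tsupport φ ⊆ Ioo 0 T) :
    ∫ t in 0..T, deriv φ t • u t = -∫ t in 0..T, φ t • u' t := by
  have h := intervalIntegral.integral_smul_deriv_eq_deriv_smul_of_hasDerivAt
    (a := 0) (b := T) (u := φ) (u' := deriv φ) (v := u) (v' := u')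
    hφ.continuous.continuousOn
    (continuous_iff_continuousAt.2 fun t => (hu t).continuousAt).continuousOn
    (fun t _ => (hφ.differentiable (by simp)).differentiableAt.hasDerivAt) (fun t _ => hu t)
    ((hφ.continuous_deriv (by simp)).intervalIntegrable _ _) (hu'.intervalIntegrable _ _)
  obtain ⟨h0, h1⟩ := eq_zero_of_tsupport_subset_Ioo hs
  rw [h, h0, h1]
  simp

/-- The classical derivative is the weak derivative. -/
lemma isWeakTimeDeriv_of_hasDerivAt {T : ℝ} (hT : 0 ≤ T) {u u' : ℝ → X}
    (hu : ∀ t, HasDerivAt u (u' t) t) (hu' : Continuous u') : IsWeakTimeDeriv T u u' := by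
  refine ⟨memLp_Ioo_of_continuousOn hu'.continuousOn, fun φ hφ _ hs => ?_⟩
  rw [integral_Ioo_eq_interval hT, integral_Ioo_eq_interval hT]
  exact integral_deriv_smul_eq_of_hasDerivAt hu hu' hφ hs

lemma IsWeakTimeDeriv.ae_eq {T : ℝ} {u v w : ℝ → X} (hv : IsWeakTimeDeriv T u v)
    (hw : IsWeakTimeDeriv T u w) : v =ᵐ[volume.restrict (Ioo 0 T)] w := by
  have hvi : Integrable v (volume.restrict (Ioo 0 T)) := hv.1.integrable (by norm_num)
  have hwi : Integrable w (volume.restrict (Ioo 0 T)) := hw.1.integrable (by norm_num)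
  have h := isOpen_Ioo.ae_eq_zero_of_integral_contDiff_smul_eq_zero
    (μ := volume.restrict (Ioo (0 : ℝ) T)) (f := v - w) (U := Ioo 0 T)
    ((hvi.sub hwi).locallyIntegrable.locallyIntegrableOn _) (fun φ hφ hc hs => by
      have h1 := hv.2 φ hφ hc hs
      rw [hw.2 φ hφ hc hs, neg_inj] at h1
      obtain ⟨C, hC⟩ := hφ.continuous.bounded_above_of_compact_support hc
      have hi : ∀ f : ℝ → X, Integrable f (volume.restrict (Ioo 0 T)) →
          Integrable (fun t => φ t • f t) (volume.restrict (Ioo 0 T)) := fun f hf =>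
        hf.bdd_smul C hφ.continuous.aestronglyMeasurable (ae_of_all _ hC)
      simp only [Pi.sub_apply, smul_sub]
      rw [integral_sub (hi v hvi) (hi w hwi), h1, sub_self])
  filter_upwards [h, ae_restrict_mem measurableSet_Ioo] with t ht hmem
  exact sub_eq_zero.1 (ht hmem)

omit [CompleteSpace X] in
lemma isWeakTimeDeriv_weakTimeDeriv {T : ℝ} {u : ℝ → X} (h : ∃ v, IsWeakTimeDeriv T u v) :
    IsWeakTimeDeriv T u (weakTimeDeriv T u) := by
  rw [weakTimeDeriv, dif_pos h]
  exact h.choose_spec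

lemma weakTimeDeriv_ae_eq {T : ℝ} {u v : ℝ → X} (h : IsWeakTimeDeriv T u v) :
    weakTimeDeriv T u =ᵐ[volume.restrict (Ioo 0 T)] v :=
  (isWeakTimeDeriv_weakTimeDeriv ⟨v, h⟩).ae_eq h

lemma hasDerivAt_integral {v : ℝ → X} (hv : Continuous v) (t : ℝ) :
    HasDerivAt (fun t => ∫ s in 0..t, v s) (v t) t :=
  intervalIntegral.integral_hasDerivAt_right (hv.intervalIntegrable 0 t)
    hv.stronglyMeasurable.stronglyMeasurableAtFilter hv.continuousAt

/-- The primitive of an integrable function has that function as weak derivative. -/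
lemma integral_deriv_smul_primitive {T : ℝ} (hT : 0 ≤ T) {v : ℝ → X}
    (hv : IntervalIntegrable v volume 0 T) {φ : ℝ → ℝ} (hφ : ContDiff ℝ ∞ φ)
    (hc : HasCompactSupport φ) (hs : tsupport φ ⊆ Ioo 0 T) :
    ∫ t in 0..T, deriv φ t • (∫ s in 0..t, v s) = -∫ t in 0..T, φ t • v t := by
  obtain ⟨C, hC⟩ := hφ.continuous.bounded_above_of_compact_support hc
  have hφ' := hφ.continuous_deriv (by simp)
  obtain ⟨C', hC'⟩ := hφ'.bounded_above_of_compact_support hc.deriv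
  have hC0 : 0 ≤ C := (norm_nonneg _).trans (hC 0)
  have hC0' : 0 ≤ C' := (norm_nonneg _).trans (hC' 0)
  have hprim : ContinuousOn (fun t => ∫ s in 0..t, v s) (uIcc 0 T) :=
    intervalIntegral.continuousOn_primitive_interval' hv left_mem_uIcc
  have hi1 : IntervalIntegrable (fun t => deriv φ t • ∫ s in 0..t, v s) volume 0 T :=
    (hφ'.continuousOn.smul hprim).intervalIntegrable
  have hi2 : IntervalIntegrable (fun t => φ t • v t) volume 0 T :=
    hv.continuousOn_smul hφ.continuous.continuousOn
  rw [← sub_eq_zero, ← norm_le_zero_iff]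
  refine le_of_forall_pos_le_add fun e he => ?_
  rw [zero_add]
  -- Integration by parts is known for continuous `γ`. The error is at most `C' T + C` times the
  -- `L¹` distance, which fixes the tolerance; the extra `1` keeps the denominator positive.
  obtain ⟨γ, hγ, hd⟩ := exists_continuous_integral_norm_sub_le hT hv
    (e := e / (C' * T + C + 1)) (by positivity)
  have hγi : ∀ t, IntervalIntegrable γ volume 0 t := fun t => hγ.intervalIntegrable _ _
  have hγφ := integral_deriv_smul_eq_of_hasDerivAt (hasDerivAt_integral hγ) hγ hφ hs
  have hprimγ : Continuous fun t => ∫ s in 0..t, γ s :=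
    continuous_iff_continuousAt.2 fun t => (hasDerivAt_integral hγ t).continuousAt
  have hj1 : IntervalIntegrable (fun t => deriv φ t • ∫ s in 0..t, γ s) volume 0 T :=
    (hφ'.smul hprimγ).intervalIntegrable _ _
  have hj2 : IntervalIntegrable (fun t => φ t • γ t) volume 0 T :=
    (hφ.continuous.smul hγ).intervalIntegrable _ _
  have hkey : (∫ t in 0..T, deriv φ t • ∫ s in 0..t, v s) - -(∫ t in 0..T, φ t • v t) =
      (∫ t in 0..T, deriv φ t • ((∫ s in 0..t, v s) - ∫ s in 0..t, γ s))
        + ∫ t in 0..T, φ t • (v t - γ t) := by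
    simp only [smul_sub]
    rw [intervalIntegral.integral_sub hi1 hj1, intervalIntegral.integral_sub hi2 hj2, hγφ]
    abel
  have hb1 : ‖∫ t in 0..T, deriv φ t • ((∫ s in 0..t, v s) - ∫ s in 0..t, γ s)‖ ≤
      C' * (e / (C' * T + C + 1)) * |T - 0| := by
    refine intervalIntegral.norm_integral_le_of_norm_le_const fun t ht => ?_
    rw [uIoc_of_le hT] at ht
    have ht' : t ∈ Icc 0 T := Ioc_subset_Icc_self ht
    have hvt : IntervalIntegrable v volume 0 t :=
      hv.mono_set (by rw [uIcc_of_le ht'.1, uIcc_of_le hT]; exact Icc_subset_Icc_right ht'.2)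
    rw [norm_smul, ← intervalIntegral.integral_sub hvt (hγi t)]
    exact mul_le_mul (hC' t)
      ((intervalIntegral.norm_integral_le_integral_norm ht'.1).trans (hd t ht'))
      (norm_nonneg _) hC0'
  have hb2 : ‖∫ t in 0..T, φ t • (v t - γ t)‖ ≤ C * (e / (C' * T + C + 1)) := by
    refine (intervalIntegral.norm_integral_le_of_norm_le (g := fun t => C * ‖v t - γ t‖) hT
      (ae_of_all _ fun t _ => ?_) ((hv.sub (hγi T)).norm.const_mul C)).trans ?_
    · rw [norm_smul]
      exact mul_le_mul_of_nonneg_right (hC t) (norm_nonneg _)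
    · rw [intervalIntegral.integral_const_mul]
      exact mul_le_mul_of_nonneg_left (hd T ⟨hT, le_rfl⟩) hC0
  rw [hkey]
  refine (norm_add_le _ _).trans ((add_le_add hb1 hb2).trans ?_)
  rw [sub_zero, abs_of_nonneg hT]
  have hden : 0 < C' * T + C + 1 := by positivity
  have : C' * (e / (C' * T + C + 1)) * T + C * (e / (C' * T + C + 1)) =
      e * ((C' * T + C) / (C' * T + C + 1)) := by ring
  rw [this]
  refine mul_le_of_le_one_right he.le ?_
  rw [div_le_one hden]
  linarith

/-- A test function on `(0,T)` with integral `0` has a primitive that is a test function. -/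
lemma contDiff_primitive_test {T : ℝ} {θ : ℝ → ℝ} {K : Set ℝ} (hθ : ContDiff ℝ ∞ θ)
    (hK : IsCompact K) (hne : K.Nonempty) (hKT : K ⊆ Ioo 0 T) (hs : Function.support θ ⊆ K)
    (h0 : ∫ t, θ t = 0) :
    ContDiff ℝ ∞ (fun t => ∫ s in 0..t, θ s) ∧ HasCompactSupport (fun t => ∫ s in 0..t, θ s) ∧
      tsupport (fun t => ∫ s in 0..t, θ s) ⊆ Ioo 0 T ∧
      deriv (fun t => ∫ s in 0..t, θ s) = θ := by
  have hd : deriv (fun t => ∫ s in 0..t, θ s) = θ :=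
    funext fun t => (hasDerivAt_integral hθ.continuous t).deriv
  have ha := hK.sInf_mem hne
  have hb := hK.sSup_mem hne
  have hsupp : Function.support (fun t => ∫ s in 0..t, θ s) ⊆ Icc (sInf K) (sSup K) := by
    intro t ht
    by_contra hmem
    refine ht ?_
    -- Left of `K` the integrand vanishes; right of `K` the integral is already the total one, which
    -- is zero.
    rcases not_and_or.1 hmem with h | h
    · refine (intervalIntegral.integral_congr (g := fun _ => 0) fun s hs' => ?_).trans (by simp)
      by_contra hne'
      have := csInf_le hK.bddBelow (hs hne')
      have h2 : s ≤ max 0 t := hs'.2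
      have h3 : max 0 t < sInf K := max_lt (hKT ha).1 (not_le.1 h)
      linarith
    · refine (intervalIntegral.integral_eq_integral_of_support_subset fun s hs' => ?_).trans h0
      exact ⟨(hKT (hs hs')).1, (le_csSup hK.bddAbove (hs hs')).trans (not_le.1 h).le⟩
  have hts : tsupport (fun t => ∫ s in 0..t, θ s) ⊆ Icc (sInf K) (sSup K) :=
    closure_minimal hsupp isClosed_Icc
  refine ⟨contDiff_infty_iff_deriv.2 ⟨fun t =>
    (hasDerivAt_integral hθ.continuous t).differentiableAt, by rw [hd]; exact hθ⟩,
    isCompact_Icc.of_isClosed_subset (isClosed_tsupport _) hts,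
    hts.trans fun t ht => ⟨(hKT ha).1.trans_le ht.1, ht.2.trans_lt (hKT hb).2⟩, hd⟩

/-- A continuous function with weak derivative `0` is constant. -/
lemma eq_of_weak_deriv_zero {T : ℝ} (hT : 0 < T) {z : ℝ → X} (hz : ContinuousOn z (Icc 0 T))
    (h : ∀ φ : ℝ → ℝ, ContDiff ℝ ∞ φ → HasCompactSupport φ → tsupport φ ⊆ Ioo 0 T →
      ∫ t in 0..T, deriv φ t • z t = 0) : ∀ t ∈ Icc 0 T, z t = z 0 := by
  have hzu : ContinuousOn z (uIcc 0 T) := by rwa [uIcc_of_le hT.le]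
  -- A fixed test function `η` of integral one, with support `[T/4, 3T/4]`; the constant will be `c
  -- = ∫ η z`.
  let b : ContDiffBump (T / 2) := ⟨T / 8, T / 4, by positivity, by linarith⟩
  let η : ℝ → ℝ := b.normed volume
  have hη : ContDiff ℝ ∞ η := b.contDiff_normed
  have hηs : tsupport η = Metric.closedBall (T / 2) (T / 4) := b.tsupport_normed_eq
  have hηc : HasCompactSupport η := b.hasCompactSupport_normed
  have hη1 : ∫ t, η t = 1 := b.integral_normed
  have hηT : tsupport η ⊆ Ioo 0 T := by
    rw [hηs, Real.closedBall_eq_Icc]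
    exact fun t ht => ⟨by linarith [ht.1], by linarith [ht.2]⟩
  have hηne : (tsupport η).Nonempty := by
    rw [hηs]; exact Metric.nonempty_closedBall.2 (by positivity)
  let c : X := ∫ t in 0..T, η t • z t
  have hkey : ∀ ψ : ℝ → ℝ, ContDiff ℝ ∞ ψ → HasCompactSupport ψ → tsupport ψ ⊆ Ioo 0 T →
      ∫ t in 0..T, ψ t • z t = (∫ t, ψ t) • c := by
    intro ψ hψ hψc hψs
    -- `θ` has integral zero, hence is the derivative of a test function and is annihilated by `z`.
    -- This is the du Bois-Reymond argument.
    let θ : ℝ → ℝ := fun t => ψ t - (∫ t, ψ t) * η t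
    have hsub : Function.support θ ⊆ tsupport ψ ∪ tsupport η := by
      intro t ht
      by_contra hn
      rw [mem_union, not_or] at hn
      refine ht ?_
      simp [θ, image_eq_zero_of_notMem_tsupport hn.1, image_eq_zero_of_notMem_tsupport hn.2]
    have hθ0 : ∫ t, θ t = 0 := by
      rw [integral_sub (hψ.continuous.integrable_of_hasCompactSupport hψc)
        ((hη.continuous.integrable_of_hasCompactSupport hηc).const_mul _),
        integral_const_mul, hη1, mul_one, sub_self]
    obtain ⟨h1, h2, h3, h4⟩ := contDiff_primitive_test (hψ.sub (contDiff_const.mul hη))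
      (hψc.isCompact.union hηc.isCompact) (hηne.mono subset_union_right)
      (union_subset hψs hηT) hsub hθ0
    have h5 := h _ h1 h2 h3
    have h6 : ∀ t, deriv (fun t => ∫ s in 0..t, (ψ s - (∫ t, ψ t) * η s)) t =
      ψ t - (∫ t, ψ t) * η t := fun t => congrFun h4 t
    simp only [h6, sub_smul, mul_smul] at h5
    rw [intervalIntegral.integral_sub (f := fun t => ψ t • z t)
      (g := fun t => (∫ t, ψ t) • η t • z t)
      (hψ.continuous.continuousOn.smul hzu).intervalIntegrable
      ((hη.continuous.continuousOn.smul hzu).const_smul _).intervalIntegrable,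
      intervalIntegral.integral_smul, sub_eq_zero] at h5
    exact h5
  have hae : ∀ᵐ t ∂(volume.restrict (Ioo 0 T)), t ∈ Ioo 0 T → z t - c = 0 := by
    have hcont : ContinuousOn (fun t => z t - c) (Icc 0 T) := hz.sub continuousOn_const
    refine isOpen_Ioo.ae_eq_zero_of_integral_contDiff_smul_eq_zero
      (((memLp_Ioo_of_continuousOn hcont).integrable
        (by norm_num)).locallyIntegrable.locallyIntegrableOn _) fun ψ hψ hψc hψs => ?_
    rw [integral_Ioo_eq_interval hT.le]
    simp only [smul_sub]
    rw [intervalIntegral.integral_sub (f := fun t => ψ t • z t) (g := fun t => ψ t • c)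
      (hψ.continuous.continuousOn.smul hzu).intervalIntegrable
      (hψ.continuous.smul continuous_const).continuousOn.intervalIntegrable, hkey ψ hψ hψc hψs,
      intervalIntegral.integral_smul_const,
      intervalIntegral.integral_eq_integral_of_support_subset, sub_self]
    exact (subset_tsupport ψ).trans (hψs.trans Ioo_subset_Ioc_self)
  have hEq : EqOn z (fun _ => c) (Icc 0 T) := by
    refine Measure.eqOn_Icc_of_ae_eq volume hT.ne ?_ hz continuousOn_const
    rw [← restrict_Ioo_eq_restrict_Icc]
    filter_upwards [hae, ae_restrict_mem measurableSet_Ioo] with t ht hmem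
    exact sub_eq_zero.1 (ht hmem)
  intro t ht
  rw [hEq ht, hEq ⟨le_rfl, hT.le⟩]

/-- The fundamental theorem of calculus in `H¹(0,T;X)`. -/
lemma eq_add_integral_of_isWeakTimeDeriv {T : ℝ} (hT : 0 < T) {u v : ℝ → X}
    (hu : ContinuousOn u (Icc 0 T)) (hv : IsWeakTimeDeriv T u v) :
    ∀ t ∈ Icc 0 T, u t = u 0 + ∫ s in 0..t, v s := by
  have hvi := intervalIntegrable_of_memLp hT.le hv.1
  have hprim : ContinuousOn (fun t => ∫ s in 0..t, v s) (Icc 0 T) := by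
    have := intervalIntegral.continuousOn_primitive_interval' hvi left_mem_uIcc
    rwa [uIcc_of_le hT.le] at this
  intro t ht
  -- `u` and the primitive of `v` have the same weak derivative, so their difference is constant.
  have := eq_of_weak_deriv_zero hT (z := fun t => u t - ∫ s in 0..t, v s) (hu.sub hprim)
      (fun φ hφ hc hs => by
    have h1 := hv.2 φ hφ hc hs
    rw [integral_Ioo_eq_interval hT.le, integral_Ioo_eq_interval hT.le] at h1
    have h2 := integral_deriv_smul_primitive hT.le hvi hφ hc hs
    have hφ' := hφ.continuous_deriv (by simp)
    simp only [smul_sub]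
    rw [intervalIntegral.integral_sub, h1, h2, sub_self]
    · exact (hφ'.continuousOn.smul (by rwa [uIcc_of_le hT.le])).intervalIntegrable
    · exact (hφ'.continuousOn.smul (by rwa [uIcc_of_le hT.le])).intervalIntegrable) t ht
  simp only [intervalIntegral.integral_same, sub_zero] at this
  exact sub_eq_iff_eq_add.1 this

end Time

/-! ### The weak curl, its adjoint, and `H₀(curl)`. -/

section Curl

variable {𝕜 : Type*} [RCLike 𝕜] {D : Set R3}

/-- The evolution theory is run over `ℝ`; this identity lets it serve real and complex fields alike.
-/
lemma inner_real_eq_re_inner (u v : L2Field 𝕜 D) : inner ℝ u v = RCLike.re (inner 𝕜 u v) := by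
  rw [L2.inner_def, L2.inner_def, ← integral_re (L2.integrable_inner u v)]
  refine integral_congr_ae (ae_of_all _ fun x => ?_)
  simp only [PiLp.inner_apply, map_sum]
  rfl

/-- The real field `g`, as a field with values in `𝕜³`. -/
def coeField (𝕜 : Type*) [RCLike 𝕜] (g : R3 → Fin 3 → ℝ) (x : R3) : EuclideanSpace 𝕜 (Fin 3) :=
  WithLp.toLp 2 fun i => (g x i : 𝕜)

lemma memLp_coeField {g : R3 → Fin 3 → ℝ} (hg : Continuous g) (hc : HasCompactSupport g) :
    MemLp (coeField 𝕜 g) 2 (volume.restrict D) := by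
  have h1 : Continuous (coeField 𝕜 g) := by
    refine (PiLp.continuous_toLp 2 _).comp (continuous_pi fun i => ?_)
    exact RCLike.continuous_ofReal.comp ((continuous_apply i).comp hg)
  have h2 : HasCompactSupport (coeField 𝕜 g) :=
    hc.comp_left (g := fun y : Fin 3 → ℝ => (WithLp.toLp 2 fun i => (y i : 𝕜)))
      (by ext i; simp)
  exact (h1.memLp_of_hasCompactSupport h2).restrict D

open Classical in
/-- The element of `L²(D)³` given by the continuous compactly supported field `g`. -/
def testField (𝕜 : Type*) [RCLike 𝕜] (D : Set R3) (g : R3 → Fin 3 → ℝ) : L2Field 𝕜 D :=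
  if h : MemLp (coeField 𝕜 g) 2 (volume.restrict D) then h.toLp _ else 0

lemma testField_ae {g : R3 → Fin 3 → ℝ} (hg : Continuous g) (hc : HasCompactSupport g) :
    testField 𝕜 D g =ᵐ[volume.restrict D] coeField 𝕜 g := by
  rw [testField, dif_pos (memLp_coeField hg hc)]
  exact MemLp.coeFn_toLp _

lemma inner_testField {g : R3 → Fin 3 → ℝ} (hg : Continuous g) (hc : HasCompactSupport g)
    (u : L2Field 𝕜 D) : inner 𝕜 (testField 𝕜 D g) u = ∫ x in D, ∑ i, g x i • u x i := by
  rw [L2.inner_def]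
  refine integral_congr_ae ?_
  filter_upwards [testField_ae (𝕜 := 𝕜) (D := D) hg hc] with x hx
  rw [hx, PiLp.inner_apply]
  refine Finset.sum_congr rfl fun i _ => ?_
  simp [coeField, RCLike.inner_apply, RCLike.real_smul_eq_coe_mul, mul_comm]

lemma continuous_partialD {φ : R3 → R3} (hφ : ContDiff ℝ ∞ φ) (i j : Fin 3) :
    Continuous (partialD φ i j) := by
  have h := (hφ.continuous_fderiv (by simp)).clm_apply
    (continuous_const (y := (EuclideanSpace.single i 1 : R3)))
  exact (EuclideanSpace.proj (𝕜 := ℝ) j).continuous.comp h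

lemma hasCompactSupport_partialD {φ : R3 → R3} (hc : HasCompactSupport φ) (i j : Fin 3) :
    HasCompactSupport (partialD φ i j) :=
  (hc.fderiv ℝ).comp_left (g := fun L : R3 →L[ℝ] R3 => L (EuclideanSpace.single i 1) j) rfl

lemma continuous_classicalCurl {φ : R3 → R3} (hφ : ContDiff ℝ ∞ φ) :
    Continuous (classicalCurl φ) := by
  refine continuous_pi fun i => ?_
  fin_cases i
  · exact (continuous_partialD hφ 1 2).sub (continuous_partialD hφ 2 1)
  · exact (continuous_partialD hφ 2 0).sub (continuous_partialD hφ 0 2)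
  · exact (continuous_partialD hφ 0 1).sub (continuous_partialD hφ 1 0)

lemma support_classicalCurl_subset (φ : R3 → R3) :
    Function.support (classicalCurl φ) ⊆ tsupport φ := by
  intro x hx
  by_contra h
  have h0 : fderiv ℝ φ x = 0 := by
    by_contra h'
    exact h (support_fderiv_subset ℝ h')
  refine hx ?_
  ext i
  fin_cases i <;> simp [classicalCurl, partialD, h0]

lemma hasCompactSupport_classicalCurl {φ : R3 → R3} (hc : HasCompactSupport φ) :
    HasCompactSupport (classicalCurl φ) :=
  HasCompactSupport.of_support_subset_isCompact hc.isCompact (support_classicalCurl_subset φ)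

lemma continuous_components {φ : R3 → R3} (hφ : ContDiff ℝ ∞ φ) :
    Continuous fun x => (φ x : Fin 3 → ℝ) :=
  (PiLp.continuous_ofLp 2 _).comp hφ.continuous

lemma hasCompactSupport_components {φ : R3 → R3} (hc : HasCompactSupport φ) :
    HasCompactSupport fun x => (φ x : Fin 3 → ℝ) :=
  hc.comp_left (g := fun v : R3 => (v : Fin 3 → ℝ)) rfl

/-- The weak curl in terms of inner products with test fields. -/
lemma isWeakCurl_iff {u w : L2Field 𝕜 D} :
    IsWeakCurl D u w ↔ ∀ φ : R3 → R3, ContDiff ℝ ∞ φ → HasCompactSupport φ → tsupport φ ⊆ D →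
      inner 𝕜 (testField 𝕜 D (classicalCurl φ)) u = inner 𝕜 (testField 𝕜 D fun x => φ x) w := by
  refine forall₄_congr fun φ hφ hc _ => ?_
  rw [inner_testField (continuous_classicalCurl hφ) (hasCompactSupport_classicalCurl hc),
    inner_testField (continuous_components hφ) (hasCompactSupport_components hc)]

lemma IsWeakCurl.add {u w u' w' : L2Field 𝕜 D} (h : IsWeakCurl D u w) (h' : IsWeakCurl D u' w') :
    IsWeakCurl D (u + u') (w + w') := by
  rw [isWeakCurl_iff] at *
  intro φ h1 h2 h3
  rw [inner_add_right, inner_add_right, h φ h1 h2 h3, h' φ h1 h2 h3]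

lemma IsWeakCurl.smul {u w : L2Field 𝕜 D} (h : IsWeakCurl D u w) (c : 𝕜) :
    IsWeakCurl D (c • u) (c • w) := by
  rw [isWeakCurl_iff] at *
  intro φ h1 h2 h3
  rw [inner_smul_right, inner_smul_right, h φ h1 h2 h3]

lemma isWeakCurl_zero : IsWeakCurl D (0 : L2Field 𝕜 D) 0 := by
  rw [isWeakCurl_iff]
  intro φ _ _ _
  rw [inner_zero_right, inner_zero_right]

lemma eq_zero_of_inner_testField (hD : IsOpen D) {w : L2Field 𝕜 D}
    (h : ∀ φ : R3 → R3, ContDiff ℝ ∞ φ → HasCompactSupport φ → tsupport φ ⊆ D →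
      inner 𝕜 (testField 𝕜 D fun x => φ x) w = 0) : w = 0 := by
  have hi : ∀ i, ∀ᵐ x ∂(volume.restrict D), x ∈ D → w x i = 0 := by
    intro i
    refine hD.ae_eq_zero_of_integral_contDiff_smul_eq_zero ?_ fun ψ hψ hψc hψs => ?_
    · have h1 : MemLp (fun x => w x i) 2 (volume.restrict D) :=
        (EuclideanSpace.proj i : EuclideanSpace 𝕜 (Fin 3) →L[𝕜] 𝕜).comp_memLp' (Lp.memLp w)
      exact (h1.locallyIntegrable (by norm_num)).locallyIntegrableOn _
    · let φ : R3 → R3 := fun x => ψ x • EuclideanSpace.single i 1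
      have hφ : ContDiff ℝ ∞ φ := hψ.smul contDiff_const
      have hφc : HasCompactSupport φ := hψc.smul_right
      have hφs : tsupport φ ⊆ D := (tsupport_smul_subset_left _ _).trans hψs
      have := h φ hφ hφc hφs
      rw [inner_testField (continuous_components hφ) (hasCompactSupport_components hφc)] at this
      rw [← this]
      refine integral_congr_ae (ae_of_all _ fun x => ?_)
      dsimp only
      rw [Finset.sum_eq_single i]
      · simp [φ]
      · intro j _ hj
        simp [φ, hj]
      · simp
  refine Lp.ext ?_
  filter_upwards [Lp.coeFn_zero (EuclideanSpace 𝕜 (Fin 3)) 2 (volume.restrict D),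
    ae_all_iff.2 hi, ae_restrict_mem hD.measurableSet] with x h0 hx hmem
  rw [h0]
  ext i
  exact hx i hmem

lemma IsWeakCurl.unique (hD : IsOpen D) {u w w' : L2Field 𝕜 D} (h : IsWeakCurl D u w)
    (h' : IsWeakCurl D u w') : w = w' := by
  rw [isWeakCurl_iff] at h h'
  refine sub_eq_zero.1 (eq_zero_of_inner_testField hD fun φ h1 h2 h3 => ?_)
  rw [inner_sub_right, ← h φ h1 h2 h3, ← h' φ h1 h2 h3, sub_self]

lemma IsWeakCurl.weakCurl_eq (hD : IsOpen D) {u w : L2Field 𝕜 D} (h : IsWeakCurl D u w) :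
    weakCurl D u = w := by
  have hex : ∃ w, IsWeakCurl D u w := ⟨w, h⟩
  rw [weakCurl, dif_pos hex]
  exact hex.choose_spec.unique hD h

lemma isWeakCurl_weakCurl {u : L2Field 𝕜 D} (h : u ∈ HCurl 𝕜 D) :
    IsWeakCurl D u (weakCurl D u) := by
  have hex : ∃ w, IsWeakCurl D u w := h
  rw [weakCurl, dif_pos hex]
  exact hex.choose_spec

/-- Integration by parts for a single partial derivative. -/
lemma integral_mul_partialD {φ ψ : R3 → R3} (hφ : ContDiff ℝ ∞ φ) (hφc : HasCompactSupport φ)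
    (hψ : ContDiff ℝ ∞ ψ) (i a b : Fin 3) :
    ∫ x, ψ x a * partialD φ i b x = -∫ x, partialD ψ i a x * φ x b := by
  have hcomp : ∀ {χ : R3 → R3}, ContDiff ℝ ∞ χ → ∀ j x, HasFDerivAt (fun x => χ x j)
      ((EuclideanSpace.proj (𝕜 := ℝ) j).comp (fderiv ℝ χ x)) x := fun hχ j x =>
    (EuclideanSpace.proj (𝕜 := ℝ) j).hasFDerivAt.comp x
      ((hχ.differentiable (by simp)) x).hasFDerivAt
  have hc : ∀ {χ : R3 → R3}, ContDiff ℝ ∞ χ → ∀ j, Continuous fun x => χ x j := fun hχ j =>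
    (EuclideanSpace.proj (𝕜 := ℝ) j).continuous.comp hχ.continuous
  have hφs : ∀ j, HasCompactSupport fun x => φ x j := fun j =>
    hφc.comp_left (g := fun v : R3 => v j) rfl
  have hf : ∀ {χ : R3 → R3}, ContDiff ℝ ∞ χ → ∀ j x,
      fderiv ℝ (fun x => χ x j) x (EuclideanSpace.single i 1) = partialD χ i j x := fun hχ j x => by
    rw [(hcomp hχ j x).fderiv]; rfl
  have := integral_mul_fderiv_eq_neg_fderiv_mul_of_integrable (μ := (volume : Measure R3))
    (f := fun x => ψ x a) (g := fun x => φ x b) (v := EuclideanSpace.single i 1)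
  simp only [hf hψ, hf hφ] at this
  refine this ?_ ?_ ?_ (fun x _ => (hcomp hψ a x).differentiableAt)
    (fun x _ => (hcomp hφ b x).differentiableAt)
  · exact ((continuous_partialD hψ i a).mul (hc hφ b)).integrable_of_hasCompactSupport
      (hφs b).mul_left
  · exact ((hc hψ a).mul (continuous_partialD hφ i b)).integrable_of_hasCompactSupport
      (hasCompactSupport_partialD hφc i b).mul_left
  · exact ((hc hψ a).mul (hc hφ b)).integrable_of_hasCompactSupport (hφs b).mul_left

lemma integral_alternating_sum {f₁ f₂ f₃ f₄ f₅ f₆ : R3 → ℝ} (h₁ : Integrable f₁)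
    (h₂ : Integrable f₂) (h₃ : Integrable f₃) (h₄ : Integrable f₄) (h₅ : Integrable f₅)
    (h₆ : Integrable f₆) :
    ∫ x, (f₁ x - f₂ x + (f₃ x - f₄ x) + (f₅ x - f₆ x)) =
      (∫ x, f₁ x) - (∫ x, f₂ x) + ((∫ x, f₃ x) - ∫ x, f₄ x) + ((∫ x, f₅ x) - ∫ x, f₆ x) := by
  have h12 : Integrable fun x => f₁ x - f₂ x := h₁.sub h₂
  have h34 : Integrable fun x => f₃ x - f₄ x := h₃.sub h₄
  have h56 : Integrable fun x => f₅ x - f₆ x := h₅.sub h₆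
  have h14 : Integrable fun x => f₁ x - f₂ x + (f₃ x - f₄ x) := h12.add h34
  rw [integral_add h14 h56, integral_add h12 h34, integral_sub h₁ h₂, integral_sub h₃ h₄,
    integral_sub h₅ h₆]

lemma integral_classicalCurl_dot {φ ψ : R3 → R3} (hφ : ContDiff ℝ ∞ φ)
    (hφc : HasCompactSupport φ) (hψ : ContDiff ℝ ∞ ψ) :
    ∫ x, ∑ i, classicalCurl ψ x i * φ x i = ∫ x, ∑ i, ψ x i * classicalCurl φ x i := by
  have hc : ∀ {χ : R3 → R3}, ContDiff ℝ ∞ χ → ∀ j, Continuous fun x => χ x j := fun hχ j =>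
    (EuclideanSpace.proj (𝕜 := ℝ) j).continuous.comp hχ.continuous
  have hφs : ∀ j, HasCompactSupport fun x => φ x j := fun j =>
    hφc.comp_left (g := fun v : R3 => v j) rfl
  have hQ : ∀ i a b, Integrable fun x => partialD ψ i a x * φ x b := fun i a b =>
    ((continuous_partialD hψ i a).mul (hc hφ b)).integrable_of_hasCompactSupport
      (hφs b).mul_left
  have hP : ∀ i a b, Integrable fun x => ψ x a * partialD φ i b x := fun i a b =>
    ((hc hψ a).mul (continuous_partialD hφ i b)).integrable_of_hasCompactSupport
      (hasCompactSupport_partialD hφc i b).mul_left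
  have hl : ∀ x, ∑ i, classicalCurl ψ x i * φ x i =
      (partialD ψ 1 2 x * φ x 0 - partialD ψ 2 1 x * φ x 0) +
      (partialD ψ 2 0 x * φ x 1 - partialD ψ 0 2 x * φ x 1) +
      (partialD ψ 0 1 x * φ x 2 - partialD ψ 1 0 x * φ x 2) := fun x => by
    simp [Fin.sum_univ_three, classicalCurl, sub_mul]
  have hr : ∀ x, ∑ i, ψ x i * classicalCurl φ x i =
      (ψ x 0 * partialD φ 1 2 x - ψ x 0 * partialD φ 2 1 x) +
      (ψ x 1 * partialD φ 2 0 x - ψ x 1 * partialD φ 0 2 x) +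
      (ψ x 2 * partialD φ 0 1 x - ψ x 2 * partialD φ 1 0 x) := fun x => by
    simp [Fin.sum_univ_three, classicalCurl, mul_sub]
  simp only [hl, hr]
  rw [integral_alternating_sum (hQ _ _ _) (hQ _ _ _) (hQ _ _ _) (hQ _ _ _) (hQ _ _ _) (hQ _ _ _),
    integral_alternating_sum (hP _ _ _) (hP _ _ _) (hP _ _ _) (hP _ _ _) (hP _ _ _) (hP _ _ _)]
  simp only [integral_mul_partialD hφ hφc hψ]
  ring

/-- The classical curl of a test field is its weak curl. -/
lemma isWeakCurl_testField {φ : R3 → R3} (hφ : ContDiff ℝ ∞ φ) (hφc : HasCompactSupport φ)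
    (hφs : tsupport φ ⊆ D) :
    IsWeakCurl D (testField 𝕜 D fun x => φ x) (testField 𝕜 D (classicalCurl φ)) := by
  intro ψ hψ hψc hψs
  have h1 : ∀ {g h : R3 → Fin 3 → ℝ}, Continuous h → HasCompactSupport h →
      Function.support h ⊆ D →
      ∫ x in D, ∑ i, g x i • testField 𝕜 D h x i = ((∫ x, ∑ i, g x i * h x i : ℝ) : 𝕜) := by
    intro g h hh hc hs
    have h2 : ∫ x in D, ∑ i, g x i • testField 𝕜 D h x i =
        ∫ x in D, ((∑ i, g x i * h x i : ℝ) : 𝕜) := by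
      refine integral_congr_ae ?_
      filter_upwards [testField_ae (𝕜 := 𝕜) (D := D) hh hc] with x hx
      rw [hx]
      simp [coeField, RCLike.real_smul_eq_coe_mul]
    rw [h2, integral_ofReal, setIntegral_eq_integral_of_forall_compl_eq_zero]
    intro x hx
    have : h x = 0 := by
      by_contra h'
      exact hx (hs h')
    simp [this]
  rw [h1 (continuous_components hφ) (hasCompactSupport_components hφc) (fun x hx => hφs
      (subset_tsupport φ fun h => hx (by simp [h]))),
    h1 (continuous_classicalCurl hφ) (hasCompactSupport_classicalCurl hφc)
      ((support_classicalCurl_subset φ).trans hφs), integral_classicalCurl_dot hφ hφc hψ]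

/-- `u` lies in the domain of the adjoint of the curl on `H(curl, D)`, and `w` is its image. -/
def IsAdjointCurl (D : Set R3) (u w : L2Field 𝕜 D) : Prop :=
  ∀ v z, IsWeakCurl D v z → inner 𝕜 u z = inner 𝕜 w v

/-- Test fields belong to `H(curl, D)` with their classical curl, so they are admissible in the
adjoint relation. -/
lemma IsAdjointCurl.isWeakCurl {u w : L2Field 𝕜 D} (h : IsAdjointCurl D u w) :
    IsWeakCurl D u w := by
  rw [isWeakCurl_iff]
  intro φ h1 h2 h3
  have := h _ _ (isWeakCurl_testField (𝕜 := 𝕜) h1 h2 h3)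
  rw [← inner_conj_symm, this, inner_conj_symm]

/-- The definition of the weak curl read from the other side; it places test fields in `H₀(curl,
D)`. -/
lemma IsWeakCurl.isAdjointCurl_testField {φ : R3 → R3} (hφ : ContDiff ℝ ∞ φ)
    (hφc : HasCompactSupport φ) (hφs : tsupport φ ⊆ D) :
    IsAdjointCurl D (testField 𝕜 D fun x => φ x) (testField 𝕜 D (classicalCurl φ)) :=
  fun _ _ h => (isWeakCurl_iff.1 h φ hφ hφc hφs).symm

lemma IsAdjointCurl.add {u w u' w' : L2Field 𝕜 D} (h : IsAdjointCurl D u w)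
    (h' : IsAdjointCurl D u' w') : IsAdjointCurl D (u + u') (w + w') := fun v z hv => by
  rw [inner_add_left, inner_add_left, h v z hv, h' v z hv]

lemma IsAdjointCurl.smul {u w : L2Field 𝕜 D} (h : IsAdjointCurl D u w) (c : 𝕜) :
    IsAdjointCurl D (c • u) (c • w) := fun v z hv => by
  rw [inner_smul_left, inner_smul_left, h v z hv]

lemma isAdjointCurl_zero : IsAdjointCurl D (0 : L2Field 𝕜 D) 0 := fun v z _ => by
  rw [inner_zero_left, inner_zero_left]

/-- When `S` is the whole boundary, `U = ∅` is allowed, so the trace is tested against all of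
`H(curl, D)`. That is the adjoint relation with `w = ∇ × u`. -/
lemma mem_HCurl0_iff (hD : IsOpen D) {u : L2Field 𝕜 D} :
    u ∈ HCurl0 𝕜 D ↔ ∃ w, IsAdjointCurl D u w := by
  constructor
  · rintro ⟨-, h⟩
    refine ⟨weakCurl D u, fun v z hv => ?_⟩
    rw [← h v ⟨z, hv⟩ ⟨∅, isOpen_empty, by simp, by simp⟩, hv.weakCurl_eq hD]
  · rintro ⟨w, h⟩
    refine ⟨⟨w, h.isWeakCurl⟩, fun v hv _ => ?_⟩
    rw [h.isWeakCurl.weakCurl_eq hD]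
    exact h v _ (isWeakCurl_weakCurl hv)

lemma HCurl0_subset_HCurlZeroOn (S : Set R3) : HCurl0 𝕜 D ⊆ HCurlZeroOn 𝕜 D S :=
  fun _ hu => ⟨hu.1, fun v hv _ => hu.2 v hv ⟨∅, isOpen_empty, by simp, by simp⟩⟩

end Curl

/-! ### The Maxwell operator as a skew-adjoint graph. -/

section MaxwellGraph

/-- The operator `N⁻¹ 𝒜 N⁻¹`, where `𝒜` has graph `G` and `M` is the inverse of `N`. -/
def weightedGraph {H : Type*} [NormedAddCommGroup H] [InnerProductSpace ℝ H]
    (G : Submodule ℝ (H × H)) (N M : H →L[ℝ] H) : Submodule ℝ (H × H) :=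
  G.comap ((M : H →ₗ[ℝ] H).prodMap (N : H →ₗ[ℝ] H))

lemma mem_weightedGraph {H : Type*} [NormedAddCommGroup H] [InnerProductSpace ℝ H]
    {G : Submodule ℝ (H × H)} {N M : H →L[ℝ] H} {x y : H} :
    (x, y) ∈ weightedGraph G N M ↔ (M x, N y) ∈ G := Iff.rfl

lemma IsSkewAdjointGraph.weighted {H : Type*} [NormedAddCommGroup H] [InnerProductSpace ℝ H]
    {G : Submodule ℝ (H × H)} (hG : IsSkewAdjointGraph G) {N M : H →L[ℝ] H}
    (hNM : ∀ x, N (M x) = x) (hMN : ∀ x, M (N x) = x)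
    (hN : ∀ x y, inner ℝ (N x) y = inner ℝ x (N y)) :
    IsSkewAdjointGraph (weightedGraph G N M) := by
  have hM : ∀ x y, inner ℝ (M x) y = inner ℝ x (M y) := fun x y => by
    rw [← hNM y, ← hN, hNM, hMN]
  refine ⟨?_, fun x y h => ?_, fun z hz => ?_⟩
  · rintro ⟨x, y⟩ hp
    have := hG.skew _ (mem_weightedGraph.1 hp)
    simpa only [← hN, hNM] using this
  · refine mem_weightedGraph.2 (hG.maximal _ _ ?_)
    rintro ⟨a, b⟩ hp
    have := h (N a, M b) (mem_weightedGraph.2 (by rwa [hMN, hNM]))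
    simpa only [hM, hN] using this
  · have := hG.single (N z) (by simpa using mem_weightedGraph.1 hz)
    rw [← hMN z, this, map_zero]

variable (𝕜 : Type*) [RCLike 𝕜] (D : Set R3)

/-- The space `L²(D)³ × L²(D)³` of pairs `(E, H)`. -/
abbrev FieldPair := WithLp 2 (L2Field 𝕜 D × L2Field 𝕜 D)

lemma isAdjointCurl_real_smul {𝕜 : Type*} [RCLike 𝕜] {D : Set R3} {u w : L2Field 𝕜 D} (c : ℝ)
    (h : IsAdjointCurl D u w) : IsAdjointCurl D (c • u) (c • w) := by
  rw [RCLike.real_smul_eq_coe_smul (K := 𝕜) c u, RCLike.real_smul_eq_coe_smul (K := 𝕜) c w]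
  exact h.smul (c : 𝕜)

lemma isWeakCurl_real_smul {𝕜 : Type*} [RCLike 𝕜] {D : Set R3} {u w : L2Field 𝕜 D} (c : ℝ)
    (h : IsWeakCurl D u w) : IsWeakCurl D (c • u) (c • w) := by
  rw [RCLike.real_smul_eq_coe_smul (K := 𝕜) c u, RCLike.real_smul_eq_coe_smul (K := 𝕜) c w]
  exact h.smul (c : 𝕜)

/-- The graph of the Maxwell operator `(E, H) ↦ (∇ × H, -∇ × E)` on `H₀(curl) × H(curl)`. -/
def maxwellGraph : Submodule ℝ (FieldPair 𝕜 D × FieldPair 𝕜 D) where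
  carrier := {p | IsWeakCurl D p.1.snd p.2.fst ∧ IsAdjointCurl D p.1.fst (-p.2.snd)}
  zero_mem' := ⟨isWeakCurl_zero, by simpa using isAdjointCurl_zero⟩
  add_mem' {p q} hp hq := ⟨hp.1.add hq.1, by
    have h := hp.2.add hq.2
    rw [← neg_add] at h
    exact h⟩
  smul_mem' c p hp := ⟨isWeakCurl_real_smul c hp.1, by
    have h := isAdjointCurl_real_smul c hp.2
    rw [smul_neg] at h
    exact h⟩

variable {𝕜 D}

lemma mem_maxwellGraph {x y : FieldPair 𝕜 D} :
    (x, y) ∈ maxwellGraph 𝕜 D ↔ IsWeakCurl D x.snd y.fst ∧ IsAdjointCurl D x.fst (-y.snd) :=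
  Iff.rfl

lemma inner_fieldPair (x y : FieldPair 𝕜 D) :
    inner ℝ x y = RCLike.re (inner 𝕜 x.fst y.fst) + RCLike.re (inner 𝕜 x.snd y.snd) := by
  rw [WithLp.prod_inner_apply, inner_real_eq_re_inner, inner_real_eq_re_inner]
  rfl

/-- Take for `c` the conjugate of `a - b`. It recovers `𝕜`-valued identities from real inner
products by scaling the test element. -/
lemma eq_of_forall_re_mul_eq {a b : 𝕜} (h : ∀ c : 𝕜, RCLike.re (c * a) = RCLike.re (c * b)) :
    a = b := by
  have h1 := h (starRingEnd 𝕜 (a - b))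
  rw [← sub_eq_zero, ← map_sub, ← mul_sub, RCLike.conj_mul, ← RCLike.ofReal_pow,
    RCLike.ofReal_re] at h1
  exact sub_eq_zero.1 (norm_eq_zero.1 (pow_eq_zero_iff (by norm_num) |>.1 h1))

/-- Skewness is the adjoint relation itself. For maximality, pairing with the graph elements `((φ,
0), (0, -∇ × φ))`, `φ` a test field, gives the weak curl of the magnetic component; pairing with
`((0, v), (∇ × v, 0))`, `v ∈ H(curl)`, gives the adjoint relation for the electric one. -/
theorem isSkewAdjointGraph_maxwell (hD : IsOpen D) :
    IsSkewAdjointGraph (maxwellGraph 𝕜 D) := by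
  refine ⟨?_, fun x y h => ?_, fun z hz => ?_⟩
  · rintro ⟨x, y⟩ hp
    obtain ⟨h1, h2⟩ := mem_maxwellGraph.1 hp
    have := h2 _ _ h1
    rw [inner_fieldPair, this, inner_neg_left, map_neg, ← inner_conj_symm y.snd, RCLike.conj_re]
    ring
  · refine mem_maxwellGraph.2 ⟨isWeakCurl_iff.2 fun φ hφ hc hs => ?_, fun v z hv => ?_⟩
    · have hmem : ∀ c : 𝕜, (WithLp.toLp 2 (c • testField 𝕜 D fun x => φ x, 0),
          WithLp.toLp 2 (0, -(c • testField 𝕜 D (classicalCurl φ)))) ∈ maxwellGraph 𝕜 D :=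
        fun c => mem_maxwellGraph.2 ⟨isWeakCurl_zero, by
          simpa using (IsWeakCurl.isAdjointCurl_testField (𝕜 := 𝕜) hφ hc hs).smul c⟩
      rw [← inner_conj_symm, ← inner_conj_symm (testField 𝕜 D fun x => φ x)]
      refine congrArg _ (eq_of_forall_re_mul_eq fun c => ?_)
      have := h _ (hmem c)
      simp only [inner_fieldPair, WithLp.toLp_fst, WithLp.toLp_snd, inner_zero_right, map_zero,
        inner_neg_right, inner_smul_right, map_neg, zero_add, add_zero] at this
      linarith
    · have hmem : ∀ c : 𝕜, (WithLp.toLp 2 (0, c • v), WithLp.toLp 2 (c • z, 0)) ∈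
          maxwellGraph 𝕜 D :=
        fun c => mem_maxwellGraph.2 ⟨hv.smul c, by simpa using isAdjointCurl_zero⟩
      refine eq_of_forall_re_mul_eq fun c => ?_
      have := h _ (hmem c)
      simp only [inner_fieldPair, WithLp.toLp_fst, WithLp.toLp_snd, inner_zero_right, map_zero,
        inner_smul_right, zero_add, add_zero] at this
      rw [inner_neg_left, mul_neg, map_neg]
      linarith
  · obtain ⟨h1, h2⟩ := mem_maxwellGraph.1 hz
    have e1 : z.fst = 0 := IsWeakCurl.unique hD h1 isWeakCurl_zero
    have e2 : -z.snd = 0 := IsWeakCurl.unique hD h2.isWeakCurl isWeakCurl_zero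
    exact WithLp.ofLp_injective 2 (Prod.ext e1 (neg_eq_zero.1 e2))

end MaxwellGraph

/-! ### Multiplication operators diagonal in the spherical basis. -/

section RadialOperators

/-- The unit vector `e_r` at `x` (zero at the origin). -/
def radialVec (x : R3) (i : Fin 3) : ℝ := x i / ‖x‖

lemma radialDiag_eq (a b : ℝ) (x : R3) :
    radialDiag a b x = a • Matrix.vecMulVec (radialVec x) (radialVec x) +
      b • (1 - Matrix.vecMulVec (radialVec x) (radialVec x)) := rfl

/-- The projection onto `e_r`; at the origin it degenerates to zero, which is still idempotent.
Hence `radialDiag` multiplies entrywise. -/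
lemma vecMulVec_radialVec_mul_self (x : R3) :
    Matrix.vecMulVec (radialVec x) (radialVec x) * Matrix.vecMulVec (radialVec x) (radialVec x) =
      Matrix.vecMulVec (radialVec x) (radialVec x) := by
  rcases eq_or_ne x 0 with rfl | hx
  · have : radialVec 0 = 0 := by ext i; simp [radialVec]
    simp [this]
  · have h1 : radialVec x ⬝ᵥ radialVec x = 1 := by
      have h2 : ‖x‖ ^ 2 ≠ 0 := pow_ne_zero 2 (norm_ne_zero_iff.2 hx)
      have h3 := EuclideanSpace.real_norm_sq_eq x
      simp only [dotProduct, radialVec, ← sq, div_pow]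
      rw [← Finset.sum_div, ← h3]
      exact div_self h2
    rw [Matrix.vecMulVec_mul_vecMulVec, h1]
    simp

lemma radialDiag_mul (a b c d : ℝ) (x : R3) :
    radialDiag a b x * radialDiag c d x = radialDiag (a * c) (b * d) x := by
  have h := vecMulVec_radialVec_mul_self x
  simp only [radialDiag_eq]
  set P := Matrix.vecMulVec (radialVec x) (radialVec x)
  simp only [mul_add, add_mul, Matrix.smul_mul, Matrix.mul_smul, mul_sub, sub_mul, h, mul_one,
    one_mul, sub_self, smul_zero, add_zero, zero_add, sub_zero, smul_smul]
  rw [mul_comm c a, mul_comm d b]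

lemma radialDiag_self (a : ℝ) (x : R3) : radialDiag a a x = a • 1 := by
  rw [radialDiag_eq, ← smul_add, add_sub_cancel]

lemma radialDiag_add (a b c d : ℝ) (x : R3) :
    radialDiag a b x + radialDiag c d x = radialDiag (a + c) (b + d) x := by
  simp only [radialDiag_eq, add_smul]
  abel

lemma radialDiag_symm (a b : ℝ) (x : R3) (i j : Fin 3) :
    radialDiag a b x i j = radialDiag a b x j i := by
  simp only [radialDiag_eq, Matrix.add_apply, Matrix.smul_apply, Matrix.sub_apply,
    Matrix.vecMulVec_apply, Matrix.one_apply, mul_comm (radialVec x i), eq_comm (a := i)]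

variable {𝕜 : Type*} [RCLike 𝕜]

/-- The action of a real matrix on `𝕜³`. -/
def matAct (K : Matrix (Fin 3) (Fin 3) ℝ) (v : EuclideanSpace 𝕜 (Fin 3)) :
    EuclideanSpace 𝕜 (Fin 3) :=
  WithLp.toLp 2 fun i => ∑ j, K i j • v j

lemma matAct_apply (K : Matrix (Fin 3) (Fin 3) ℝ) (v : EuclideanSpace 𝕜 (Fin 3)) (i : Fin 3) :
    matAct K v i = ∑ j, K i j • v j := rfl

lemma matAct_add (K : Matrix (Fin 3) (Fin 3) ℝ) (v w : EuclideanSpace 𝕜 (Fin 3)) :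
    matAct K (v + w) = matAct K v + matAct K w := by
  ext i
  simp [matAct_apply, smul_add, Finset.sum_add_distrib]

lemma matAct_smul (K : Matrix (Fin 3) (Fin 3) ℝ) (c : ℝ) (v : EuclideanSpace 𝕜 (Fin 3)) :
    matAct K (c • v) = c • matAct K v := by
  ext i
  simp [matAct_apply, Finset.smul_sum, smul_comm c]

lemma add_matAct (K L : Matrix (Fin 3) (Fin 3) ℝ) (v : EuclideanSpace 𝕜 (Fin 3)) :
    matAct (K + L) v = matAct K v + matAct L v := by
  ext i
  simp [matAct_apply, add_smul, Finset.sum_add_distrib]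

lemma smul_one_matAct (c : ℝ) (v : EuclideanSpace 𝕜 (Fin 3)) :
    matAct (c • (1 : Matrix (Fin 3) (Fin 3) ℝ)) v = c • v := by
  ext i
  simp [matAct_apply, Matrix.one_apply, ite_smul]

lemma matAct_mul (K L : Matrix (Fin 3) (Fin 3) ℝ) (v : EuclideanSpace 𝕜 (Fin 3)) :
    matAct (K * L) v = matAct K (matAct L v) := by
  ext i
  simp only [matAct_apply, Matrix.mul_apply, Finset.sum_smul, Finset.smul_sum, smul_smul]
  exact Finset.sum_comm

lemma inner_matAct_radialDiag (a b : ℝ) (x : R3) (v w : EuclideanSpace 𝕜 (Fin 3)) :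
    inner 𝕜 (matAct (radialDiag a b x) v) w = inner 𝕜 v (matAct (radialDiag a b x) w) := by
  simp only [PiLp.inner_apply, matAct_apply, sum_inner, inner_sum]
  rw [Finset.sum_comm]
  refine Finset.sum_congr rfl fun i _ => Finset.sum_congr rfl fun j _ => ?_
  rw [radialDiag_symm a b x j i, RCLike.real_smul_eq_coe_smul (K := 𝕜),
    RCLike.real_smul_eq_coe_smul (K := 𝕜), inner_smul_left, inner_smul_right, RCLike.conj_ofReal]

/-- Split `c²` as `diag{a², b², b²} + diag{c² - a², c² - b², c² - b²}`. Both summands are squares of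
symmetric matrices, so `c² ‖v‖²` is `‖matAct (radialDiag a b x) v‖²` plus another square. -/
lemma norm_matAct_radialDiag_le {a b c : ℝ} (ha : |a| ≤ c) (hb : |b| ≤ c) (x : R3)
    (v : EuclideanSpace 𝕜 (Fin 3)) : ‖matAct (radialDiag a b x) v‖ ≤ c * ‖v‖ := by
  have hc : 0 ≤ c := (abs_nonneg a).trans ha
  have hsq : ∀ p q : ℝ, ‖matAct (radialDiag p q x) v‖ ^ 2 =
      RCLike.re (inner 𝕜 v (matAct (radialDiag (p * p) (q * q) x) v)) := fun p q => by
    rw [← radialDiag_mul, matAct_mul, ← inner_matAct_radialDiag, inner_self_eq_norm_sq]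
  have ha' : 0 ≤ c * c - a * a := by nlinarith [abs_nonneg a, sq_abs a]
  have hb' : 0 ≤ c * c - b * b := by nlinarith [abs_nonneg b, sq_abs b]
  have h1 := hsq a b
  have h2 := hsq (Real.sqrt (c * c - a * a)) (Real.sqrt (c * c - b * b))
  have h3 := hsq c c
  rw [Real.mul_self_sqrt ha', Real.mul_self_sqrt hb'] at h2
  have h4 : radialDiag (c * c) (c * c) x =
      radialDiag (a * a) (b * b) x + radialDiag (c * c - a * a) (c * c - b * b) x := by
    rw [radialDiag_add, add_sub_cancel, add_sub_cancel]
  rw [h4, add_matAct, inner_add_right, map_add, ← h1, ← h2, radialDiag_self, smul_one_matAct,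
    norm_smul, Real.norm_of_nonneg hc] at h3
  refine le_of_sq_le_sq ?_ (by positivity)
  nlinarith [sq_nonneg ‖matAct (radialDiag (Real.sqrt (c * c - a * a))
    (Real.sqrt (c * c - b * b)) x) v‖]

/-- Bounded measurable functions `a`, `b`, defining the matrix field `diag{a, b, b}` in the
spherical basis. -/
structure RadialWeight where
  a : R3 → ℝ
  b : R3 → ℝ
  bound : ℝ
  measurable_a : Measurable a
  measurable_b : Measurable b
  abs_a_le : ∀ x, |a x| ≤ bound
  abs_b_le : ∀ x, |b x| ≤ bound

namespace RadialWeight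

variable (W W' : RadialWeight) {D : Set R3}

/-- The matrix field `diag{a, b, b}`. -/
def mat (x : R3) : Matrix (Fin 3) (Fin 3) ℝ := radialDiag (W.a x) (W.b x) x

lemma measurable_mat (i j : Fin 3) : Measurable fun x => W.mat x i j := by
  have hv : ∀ i, Measurable fun x : R3 => radialVec x i := fun i =>
    ((EuclideanSpace.proj (𝕜 := ℝ) i).continuous.measurable).div measurable_norm
  simp only [mat, radialDiag_eq, Matrix.add_apply, Matrix.smul_apply, Matrix.sub_apply,
    Matrix.vecMulVec_apply, smul_eq_mul]
  exact (W.measurable_a.mul ((hv i).mul (hv j))).add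
    (W.measurable_b.mul (measurable_const.sub ((hv i).mul (hv j))))

lemma norm_matAct_le (x : R3) (v : EuclideanSpace 𝕜 (Fin 3)) :
    ‖matAct (W.mat x) v‖ ≤ W.bound * ‖v‖ :=
  norm_matAct_radialDiag_le (W.abs_a_le x) (W.abs_b_le x) x v

lemma memLp_matAct (u : L2Field 𝕜 D) :
    MemLp (fun x => matAct (W.mat x) (u x)) 2 (volume.restrict D) := by
  refine MemLp.of_le_mul (Lp.memLp u) ?_ (ae_of_all _ fun x => W.norm_matAct_le x (u x))
  have hu : AEStronglyMeasurable (fun x => u x) (volume.restrict D) := (Lp.memLp u).1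
  refine (PiLp.continuous_toLp 2 _).comp_aestronglyMeasurable
    (aemeasurable_pi_iff.2 fun i => ?_).aestronglyMeasurable
  refine (Finset.aestronglyMeasurable_fun_sum _ fun j _ => ?_).aemeasurable
  exact (W.measurable_mat i j).aestronglyMeasurable.smul
    ((EuclideanSpace.proj j :
      EuclideanSpace 𝕜 (Fin 3) →L[𝕜] 𝕜).continuous.comp_aestronglyMeasurable hu)

/-- Multiplication by the matrix field `diag{a, b, b}` on `L²(D)³`. -/
def op (𝕜 : Type*) [RCLike 𝕜] (D : Set R3) : L2Field 𝕜 D →L[ℝ] L2Field 𝕜 D :=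
  LinearMap.mkContinuous
    { toFun := fun u => (W.memLp_matAct u).toLp _
      map_add' := fun u v => by
        refine Lp.ext ?_
        filter_upwards [(W.memLp_matAct u).coeFn_toLp, (W.memLp_matAct v).coeFn_toLp,
          (W.memLp_matAct (u + v)).coeFn_toLp, Lp.coeFn_add u v,
          Lp.coeFn_add ((W.memLp_matAct u).toLp _) ((W.memLp_matAct v).toLp _)]
          with x h1 h2 h3 h4 h5
        rw [h3, h5, h4, Pi.add_apply, Pi.add_apply, h1, h2, matAct_add]
      map_smul' := fun c u => by
        refine Lp.ext ?_
        filter_upwards [(W.memLp_matAct u).coeFn_toLp,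
          (W.memLp_matAct (c • u)).coeFn_toLp, Lp.coeFn_smul c u,
          Lp.coeFn_smul c ((W.memLp_matAct u).toLp _)]
          with x h1 h2 h3 h4
        simp only [RingHom.id_apply]
        rw [h2, h4, h3, Pi.smul_apply, Pi.smul_apply, h1, matAct_smul] }
    W.bound fun u => by
      refine Lp.norm_le_mul_norm_of_ae_le_mul ?_
      filter_upwards [(W.memLp_matAct u).coeFn_toLp] with x h1
      rw [LinearMap.coe_mk, AddHom.coe_mk, h1]
      exact W.norm_matAct_le x (u x)

lemma op_ae (u : L2Field 𝕜 D) :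
    W.op 𝕜 D u =ᵐ[volume.restrict D] fun x => matAct (W.mat x) (u x) :=
  (W.memLp_matAct u).coeFn_toLp

lemma norm_op_apply_le (u : L2Field 𝕜 D) : ‖W.op 𝕜 D u‖ ≤ W.bound * ‖u‖ := by
  refine Lp.norm_le_mul_norm_of_ae_le_mul ?_
  filter_upwards [W.op_ae u] with x h1
  rw [h1]
  exact W.norm_matAct_le x (u x)

lemma inner_op (u v : L2Field 𝕜 D) : inner ℝ (W.op 𝕜 D u) v = inner ℝ u (W.op 𝕜 D v) := by
  rw [inner_real_eq_re_inner, inner_real_eq_re_inner, L2.inner_def, L2.inner_def]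
  congr 1
  refine integral_congr_ae ?_
  filter_upwards [W.op_ae u, W.op_ae v] with x h1 h2
  rw [h1, h2]
  exact inner_matAct_radialDiag _ _ _ _ _

lemma op_op_ae (u : L2Field 𝕜 D) : W.op 𝕜 D (W'.op 𝕜 D u) =ᵐ[volume.restrict D]
    fun x => matAct (radialDiag (W.a x * W'.a x) (W.b x * W'.b x) x) (u x) := by
  filter_upwards [W.op_ae (W'.op 𝕜 D u), W'.op_ae u] with x h1 h2
  rw [h1, h2, ← matAct_mul, mat, mat, radialDiag_mul]

lemma op_op_eq_self (h : ∀ x ≠ 0, W.a x * W'.a x = 1 ∧ W.b x * W'.b x = 1) (u : L2Field 𝕜 D) :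
    W.op 𝕜 D (W'.op 𝕜 D u) = u := by
  refine Lp.ext ?_
  have h0 : ∀ᵐ x ∂(volume.restrict D), x ≠ (0 : R3) :=
    ae_restrict_of_ae (Measure.ae_ne volume 0)
  filter_upwards [W.op_op_ae W' u, h0] with x h1 hx
  rw [h1, (h x hx).1, (h x hx).2, radialDiag_self, smul_one_matAct, one_smul]

end RadialWeight

end RadialOperators

/-! ### Bounds for `α`, `β` and the square root of `(BA)⁻¹`. -/

section Profile

variable {σ₀ R ρ T : ℝ} {m : ℕ}

lemma sigma_mem_Icc (hσ : 0 < σ₀) (hR : R < ρ) (r : ℝ) : sigma σ₀ R ρ m r ∈ Icc 0 σ₀ := by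
  have hd : 0 < ρ - R := sub_pos.2 hR
  unfold sigma
  split_ifs with h1 h2
  · exact ⟨le_rfl, hσ.le⟩
  · have h3 : 0 ≤ (r - R) / (ρ - R) := div_nonneg (by linarith) hd.le
    have h4 : (r - R) / (ρ - R) ≤ 1 := (div_le_one hd).2 (by linarith)
    exact ⟨mul_nonneg hσ.le (pow_nonneg h3 m),
      mul_le_of_le_one_right hσ.le (pow_le_one₀ h3 h4)⟩
  · exact ⟨hσ.le, le_rfl⟩

lemma monotone_sigma (hσ : 0 < σ₀) (hR : R < ρ) : Monotone (sigma σ₀ R ρ m) := by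
  intro r s hrs
  have hd : 0 < ρ - R := sub_pos.2 hR
  by_cases h1 : r ≤ R
  · have : sigma σ₀ R ρ m r = 0 := if_pos h1
    rw [this]
    exact (sigma_mem_Icc hσ hR s).1
  by_cases h2 : s ≤ ρ
  · have h3 : ¬ s ≤ R := fun h => h1 (hrs.trans h)
    simp only [sigma, if_neg h1, if_neg h3, if_pos h2, if_pos (hrs.trans h2)]
    have h4 : 0 ≤ (r - R) / (ρ - R) := div_nonneg (by linarith) hd.le
    gcongr
  · have : sigma σ₀ R ρ m s = σ₀ := by
      simp only [sigma, if_neg h2, if_neg (fun h => h1 (hrs.trans h))]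
    rw [this]
    exact (sigma_mem_Icc hσ hR r).2

lemma alpha_mem_Icc (hσ : 0 < σ₀) (hR : R < ρ) (hT : 0 < T) (r : ℝ) :
    alpha (1 / T) σ₀ R ρ m r ∈ Icc 1 (1 + σ₀ * T) := by
  obtain ⟨h1, h2⟩ := sigma_mem_Icc (m := m) hσ hR r
  rw [alpha, one_div, inv_inv]
  exact ⟨by nlinarith, by nlinarith⟩

lemma monotone_alpha (hσ : 0 < σ₀) (hR : R < ρ) (hT : 0 < T) :
    Monotone (alpha (1 / T) σ₀ R ρ m) := fun r s h => by
  have := monotone_sigma (m := m) hσ hR h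
  rw [alpha, alpha, one_div, inv_inv]
  nlinarith

lemma beta_zero : beta (1 / T) σ₀ R ρ m 0 = 0 := by simp [beta]

/-- `β(r)` is the mean over `[0, r]` of the nondecreasing function `α ≥ 1`. -/
lemma beta_mem_Icc (hσ : 0 < σ₀) (hR : R < ρ) (hT : 0 < T) {r : ℝ} (hr : 0 < r) :
    beta (1 / T) σ₀ R ρ m r ∈ Icc 1 (alpha (1 / T) σ₀ R ρ m r) := by
  have hint : IntervalIntegrable (alpha (1 / T) σ₀ R ρ m) volume 0 r :=
    (monotone_alpha hσ hR hT).intervalIntegrable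
  have h1 := intervalIntegral.integral_mono_on hr.le
    (intervalIntegrable_const (c := (1 : ℝ))) hint
    fun s _ => (alpha_mem_Icc (m := m) hσ hR hT s).1
  have h2 := intervalIntegral.integral_mono_on hr.le hint
    (intervalIntegrable_const (c := alpha (1 / T) σ₀ R ρ m r))
    fun s hs => monotone_alpha hσ hR hT hs.2
  rw [intervalIntegral.integral_const, sub_zero, smul_eq_mul] at h1 h2
  rw [beta, inv_mul_eq_div]
  exact ⟨(le_div_iff₀ hr).2 (by linarith), (div_le_iff₀ hr).2 (by linarith)⟩

lemma beta_nonneg_le (hσ : 0 < σ₀) (hR : R < ρ) (hT : 0 < T) {r : ℝ} (hr : 0 ≤ r) :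
    0 ≤ beta (1 / T) σ₀ R ρ m r ∧ beta (1 / T) σ₀ R ρ m r ≤ alpha (1 / T) σ₀ R ρ m r := by
  rcases hr.eq_or_lt with rfl | hr
  · rw [beta_zero]
    exact ⟨le_rfl, zero_le_one.trans (alpha_mem_Icc hσ hR hT 0).1⟩
  · have := beta_mem_Icc (m := m) hσ hR hT hr
    exact ⟨zero_le_one.trans this.1, this.2⟩

lemma measurable_alpha (hσ : 0 < σ₀) (hR : R < ρ) (hT : 0 < T) :
    Measurable (alpha (1 / T) σ₀ R ρ m) := (monotone_alpha hσ hR hT).measurable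

lemma measurable_beta (hσ : 0 < σ₀) (hR : R < ρ) (hT : 0 < T) :
    Measurable (beta (1 / T) σ₀ R ρ m) := by
  refine measurable_inv.mul (Continuous.measurable ?_)
  exact intervalIntegral.continuous_primitive
    (fun a b => (monotone_alpha hσ hR hT).intervalIntegrable) 0

/-- The square root of `(BA)⁻¹ = diag{β²/α, α, α}`. -/
def sqrtWeight (hσ : 0 < σ₀) (hR : R < ρ) (hT : 0 < T) (m : ℕ) : RadialWeight where
  a x := beta (1 / T) σ₀ R ρ m ‖x‖ / Real.sqrt (alpha (1 / T) σ₀ R ρ m ‖x‖)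
  b x := Real.sqrt (alpha (1 / T) σ₀ R ρ m ‖x‖)
  bound := Real.sqrt (1 + σ₀ * T)
  measurable_a := ((measurable_beta hσ hR hT).comp measurable_norm).div
    ((measurable_alpha hσ hR hT).comp measurable_norm).sqrt
  measurable_b := ((measurable_alpha hσ hR hT).comp measurable_norm).sqrt
  abs_a_le x := by
    obtain ⟨h1, h2⟩ := alpha_mem_Icc (m := m) hσ hR hT ‖x‖
    obtain ⟨h3, h4⟩ := beta_nonneg_le (m := m) hσ hR hT (norm_nonneg x)
    have hpos : 0 < Real.sqrt (alpha (1 / T) σ₀ R ρ m ‖x‖) := Real.sqrt_pos.2 (by linarith)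
    rw [abs_of_nonneg (by positivity)]
    refine le_trans ?_ (Real.sqrt_le_sqrt h2)
    -- `β ≤ α` turns `β / √α` into at most `√α`.
    rw [div_le_iff₀ hpos, Real.mul_self_sqrt (by linarith)]
    exact h4
  abs_b_le x := by
    rw [abs_of_nonneg (Real.sqrt_nonneg _)]
    exact Real.sqrt_le_sqrt (alpha_mem_Icc hσ hR hT ‖x‖).2

/-- The inverse of the square root of `(BA)⁻¹`. -/
def invSqrtWeight (hσ : 0 < σ₀) (hR : R < ρ) (hT : 0 < T) (m : ℕ) : RadialWeight where
  a x := Real.sqrt (alpha (1 / T) σ₀ R ρ m ‖x‖) / beta (1 / T) σ₀ R ρ m ‖x‖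
  b x := (Real.sqrt (alpha (1 / T) σ₀ R ρ m ‖x‖))⁻¹
  bound := Real.sqrt (1 + σ₀ * T)
  measurable_a := ((measurable_alpha hσ hR hT).comp measurable_norm).sqrt.div
    ((measurable_beta hσ hR hT).comp measurable_norm)
  measurable_b := ((measurable_alpha hσ hR hT).comp measurable_norm).sqrt.inv
  abs_a_le x := by
    -- At the origin `β = 0` and the quotient is `0` by convention; elsewhere `β ≥ 1`.
    rcases (norm_nonneg x).eq_or_lt with h | h
    · rw [← h, beta_zero, div_zero, abs_zero]
      positivity
    · have h1 := (beta_mem_Icc (m := m) hσ hR hT h).1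
      rw [abs_of_nonneg (by positivity)]
      exact (div_le_self (Real.sqrt_nonneg _) h1).trans
        (Real.sqrt_le_sqrt (alpha_mem_Icc hσ hR hT ‖x‖).2)
  abs_b_le x := by
    obtain ⟨h1, h2⟩ := alpha_mem_Icc (m := m) hσ hR hT ‖x‖
    rw [abs_of_nonneg (by positivity)]
    exact (inv_le_one_of_one_le₀ (Real.one_le_sqrt.2 h1)).trans
      (Real.one_le_sqrt.2 (h1.trans h2))

variable (hσ : 0 < σ₀) (hR : R < ρ) (hT : 0 < T) {𝕜 : Type*} [RCLike 𝕜] {D : Set R3}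

lemma sqrtWeight_mul_invSqrtWeight {x : R3} (hx : x ≠ 0) :
    (sqrtWeight hσ hR hT m).a x * (invSqrtWeight hσ hR hT m).a x = 1 ∧
      (sqrtWeight hσ hR hT m).b x * (invSqrtWeight hσ hR hT m).b x = 1 := by
  have h1 : 0 < Real.sqrt (alpha (1 / T) σ₀ R ρ m ‖x‖) :=
    Real.sqrt_pos.2 (zero_lt_one.trans_le (alpha_mem_Icc hσ hR hT ‖x‖).1)
  have h2 : 0 < beta (1 / T) σ₀ R ρ m ‖x‖ :=
    zero_lt_one.trans_le (beta_mem_Icc hσ hR hT (norm_pos_iff.2 hx)).1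
  exact ⟨by simp only [sqrtWeight, invSqrtWeight]; field_simp,
    by simp only [sqrtWeight, invSqrtWeight]; field_simp⟩

lemma sqrtWeight_op_invSqrtWeight (u : L2Field 𝕜 D) :
    (sqrtWeight hσ hR hT m).op 𝕜 D ((invSqrtWeight hσ hR hT m).op 𝕜 D u) = u :=
  RadialWeight.op_op_eq_self _ _ (fun _ hx => sqrtWeight_mul_invSqrtWeight hσ hR hT hx) u

lemma invSqrtWeight_op_sqrtWeight (u : L2Field 𝕜 D) :
    (invSqrtWeight hσ hR hT m).op 𝕜 D ((sqrtWeight hσ hR hT m).op 𝕜 D u) = u :=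
  RadialWeight.op_op_eq_self _ _ (fun x hx => by
    rw [mul_comm, mul_comm ((invSqrtWeight hσ hR hT m).b x)]
    exact sqrtWeight_mul_invSqrtWeight hσ hR hT hx) u

include hσ hR hT in
-- Here `BA = diag{α/β², 1/α, 1/α}`. The origin, where `β` takes the value `0`, is excluded; it is a
-- null set.
lemma inv_matB_mul_matA {x : R3} (hx : x ≠ 0) :
    (matB (1 / T) σ₀ R ρ m x * matA (1 / T) σ₀ R ρ m x)⁻¹ =
      radialDiag (beta (1 / T) σ₀ R ρ m ‖x‖ ^ 2 / alpha (1 / T) σ₀ R ρ m ‖x‖)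
        (alpha (1 / T) σ₀ R ρ m ‖x‖) x := by
  have h1 : 0 < alpha (1 / T) σ₀ R ρ m ‖x‖ :=
    zero_lt_one.trans_le (alpha_mem_Icc hσ hR hT ‖x‖).1
  have h2 : 0 < beta (1 / T) σ₀ R ρ m ‖x‖ :=
    zero_lt_one.trans_le (beta_mem_Icc hσ hR hT (norm_pos_iff.2 hx)).1
  refine Matrix.inv_eq_right_inv ?_
  rw [matA, matB, radialDiag_mul, radialDiag_mul]
  have e1 : alpha (1 / T) σ₀ R ρ m ‖x‖ * (beta (1 / T) σ₀ R ρ m ‖x‖ ^ 2)⁻¹ *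
      (beta (1 / T) σ₀ R ρ m ‖x‖ ^ 2 / alpha (1 / T) σ₀ R ρ m ‖x‖) = 1 := by field_simp
  have e2 : beta (1 / T) σ₀ R ρ m ‖x‖ * ((alpha (1 / T) σ₀ R ρ m ‖x‖)⁻¹ *
      (beta (1 / T) σ₀ R ρ m ‖x‖)⁻¹) * alpha (1 / T) σ₀ R ρ m ‖x‖ = 1 := by field_simp
  rw [e1, e2, radialDiag_self, one_smul]

/-- The square of the multiplication by `sqrtWeight` is the multiplication by `(BA)⁻¹`. -/
lemma sqrtWeight_op_op_ae (u : L2Field 𝕜 D) :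
    (sqrtWeight hσ hR hT m).op 𝕜 D ((sqrtWeight hσ hR hT m).op 𝕜 D u) =ᵐ[volume.restrict D]
      fun x => medium (1 / T) σ₀ R ρ m x (u x) := by
  have h0 : ∀ᵐ x ∂(volume.restrict D), x ≠ (0 : R3) :=
    ae_restrict_of_ae (Measure.ae_ne volume 0)
  filter_upwards [(sqrtWeight hσ hR hT m).op_op_ae (sqrtWeight hσ hR hT m) u, h0] with x h1 hx
  have h2 : 0 ≤ alpha (1 / T) σ₀ R ρ m ‖x‖ :=
    zero_le_one.trans (alpha_mem_Icc hσ hR hT ‖x‖).1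
  have h3 : medium (1 / T) σ₀ R ρ m x (u x) =
    matAct ((matB (1 / T) σ₀ R ρ m x * matA (1 / T) σ₀ R ρ m x)⁻¹) (u x) := rfl
  rw [h1, h3, inv_matB_mul_matA hσ hR hT hx]
  congr 2
  · simp only [sqrtWeight]
    rw [div_mul_div_comm, Real.mul_self_sqrt h2, sq]
  · exact Real.mul_self_sqrt h2

end Profile

/-! ### Evolution equations with a weight in front of the time derivative. -/

section WeightedEvolution

lemma _root_.IntervalIntegrable.clm_comp {X Y : Type*} [NormedAddCommGroup X] [NormedSpace ℝ X]
    [NormedAddCommGroup Y] [NormedSpace ℝ Y] {f : ℝ → X} {a b : ℝ}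
    (hf : IntervalIntegrable f volume a b) (L : X →L[ℝ] Y) :
    IntervalIntegrable (fun t => L (f t)) volume a b :=
  ⟨L.integrable_comp hf.1, L.integrable_comp hf.2⟩

variable {H : Type*} [NormedAddCommGroup H] [InnerProductSpace ℝ H] [CompleteSpace H]
  {G : Submodule ℝ (H × H)}

/-- By `maximal`, membership is a family of scalar identities, each linear and continuous, so each
can be integrated. -/
lemma IsSkewAdjointGraph.integral_mem (hG : IsSkewAdjointGraph G) {x y : ℝ → H} {t : ℝ}
    (ht : 0 ≤ t) (hx : IntervalIntegrable x volume 0 t) (hy : IntervalIntegrable y volume 0 t)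
    (h : ∀ᵐ s ∂(volume.restrict (Ioc 0 t)), (x s, y s) ∈ G) :
    (∫ s in 0..t, x s, ∫ s in 0..t, y s) ∈ G := by
  refine hG.maximal _ _ fun q hq => ?_
  have h1 := (innerSL ℝ q.2).intervalIntegral_comp_comm hx
  have h2 := (innerSL ℝ q.1).intervalIntegral_comp_comm hy
  simp only [innerSL_apply_apply] at h1 h2
  rw [real_inner_comm, real_inner_comm q.1, ← h1, ← h2, ← intervalIntegral.integral_add
    (f := fun s => inner ℝ q.2 (x s)) (g := fun s => inner ℝ q.1 (y s))
    (hx.clm_comp (innerSL ℝ q.2)) (hy.clm_comp (innerSL ℝ q.1)),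
    intervalIntegral.integral_of_le ht]
  refine integral_eq_zero_of_ae ?_
  filter_upwards [h] with s hs
  have := hG.polar hs hq
  rw [real_inner_comm, real_inner_comm q.1] at this
  exact this

/-- Existence for `P² z' = 𝒜 z + ∫ f`, `z(0) = 0`, in integrated form, with `ζ = z'`. -/
theorem IsSkewAdjointGraph.exists_weighted (hG : IsSkewAdjointGraph G) {P Q : H →L[ℝ] H}
    (hPQ : ∀ x, P (Q x) = x) (hQP : ∀ x, Q (P x) = x)
    (hP : ∀ x y, inner ℝ (P x) y = inner ℝ x (P y)) {K : ℝ} (hK : 0 ≤ K)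
    (hQ : ∀ x, ‖Q x‖ ≤ K * ‖x‖) {T : ℝ} (hT : 0 ≤ T) {f : ℝ → H}
    (hf : IntervalIntegrable f volume 0 T) :
    ∃ ζ : ℝ → H, Continuous ζ ∧ ∀ t ∈ Icc 0 T,
      (∫ s in 0..t, ζ s, P (P (ζ t)) - ∫ s in 0..t, f s) ∈ G ∧
      ‖ζ t‖ ≤ K ^ 2 * ∫ s in 0..T, ‖f s‖ := by
  have hg : IntervalIntegrable (fun s => Q (f s)) volume 0 T := hf.clm_comp Q
  -- The unknown is `w = P ζ` and the source is `Q f`; one `Q` in each accounts for `K ^ 2`.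
  obtain ⟨w, hw, hmem, hbd⟩ := (hG.weighted hPQ hQP hP).exists_mild hT hg
  refine ⟨fun t => Q (w t), Q.continuous.comp hw, fun t ht => ⟨?_, ?_⟩⟩
  · have hft : IntervalIntegrable f volume 0 t :=
      hf.mono_set (by rw [uIcc_of_le ht.1, uIcc_of_le hT]; exact Icc_subset_Icc_right ht.2)
    have := mem_weightedGraph.1 (hmem t ht)
    rw [Q.intervalIntegral_comp_comm hft, map_sub, hPQ] at this
    rwa [Q.intervalIntegral_comp_comm (hw.intervalIntegrable _ _), hPQ]
  · have h1 : ∫ s in 0..T, ‖Q (f s)‖ ≤ ∫ s in 0..T, K * ‖f s‖ :=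
      intervalIntegral.integral_mono_on hT hg.norm (hf.norm.const_mul _) fun s _ => hQ _
    rw [intervalIntegral.integral_const_mul] at h1
    calc ‖Q (w t)‖ ≤ K * ‖w t‖ := hQ _
      _ ≤ K * (K * ∫ s in 0..T, ‖f s‖) :=
        mul_le_mul_of_nonneg_left ((hbd t ht).trans h1) hK
      _ = _ := by ring

/-- Uniqueness for `P² z' = 𝒜 z`, `z(0) = 0`, in integrated form. -/
theorem IsSkewAdjointGraph.eq_zero_of_weighted (hG : IsSkewAdjointGraph G) {P Q : H →L[ℝ] H}
    (hQP : ∀ x, Q (P x) = x) (hP : ∀ x y, inner ℝ (P x) y = inner ℝ x (P y)) {T : ℝ} (hT : 0 < T)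
    {z ζ : ℝ → H} (hζ : IntervalIntegrable ζ volume 0 T)
    (hz : ∀ t ∈ Icc 0 T, z t = ∫ s in 0..t, ζ s)
    (h : ∀ᵐ s ∂(volume.restrict (Ioo 0 T)), (z s, P (P (ζ s))) ∈ G) :
    ∀ t ∈ Icc 0 T, z t = 0 := by
  have hzc : ContinuousOn z (Icc 0 T) := by
    have := intervalIntegral.continuousOn_primitive_interval' hζ left_mem_uIcc
    rw [uIcc_of_le hT.le] at this
    exact this.congr hz
  let Z : ℝ → H := IccExtend hT.le ((Icc 0 T).domRestrict z)
  have hZc : Continuous Z := (continuousOn_iff_continuous_domRestrict.1 hzc).Icc_extend'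
  have hZ : ∀ t ∈ Icc 0 T, Z t = z t := fun t ht => IccExtend_of_mem _ _ ht
  have hU := hasDerivAt_integral hZc
  have hmem : ∀ t ∈ Icc 0 T, (∫ s in 0..t, Z s, P (P (Z t))) ∈ G := by
    intro t ht
    have hζt : IntervalIntegrable ζ volume 0 t :=
      hζ.mono_set (by rw [uIcc_of_le ht.1, uIcc_of_le hT.le]; exact Icc_subset_Icc_right ht.2)
    have h1 : P (P (Z t)) = ∫ s in 0..t, (P.comp P) (ζ s) := by
      rw [(P.comp P).intervalIntegral_comp_comm hζt, hZ t ht, hz t ht]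
      rfl
    rw [h1]
    refine hG.integral_mem ht.1 (hZc.intervalIntegrable _ _)
      (hζt.clm_comp (P.comp P)) ?_
    rw [restrict_Ioo_eq_restrict_Ioc] at h
    filter_upwards [ae_restrict_of_ae_restrict_of_subset (Ioc_subset_Ioc_right ht.2) h,
      ae_restrict_mem measurableSet_Ioc] with s hs hst
    rw [hZ s ⟨hst.1.le, hst.2.trans ht.2⟩]
    exact hs
  -- With `U = ∫ Z` and `V = P U`, `⟨V, V'⟩ = ⟨U, P² Z⟩ = 0`, because `(U, P² Z)` lies in the graph.
  -- Integrating once has turned the almost-everywhere equation into one valid at every time.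
  have hV := eq_zero_of_hasDerivAt_of_skew (T := T)
    (fun t => P.hasFDerivAt.comp_hasDerivAt t (hU t)) (by simp) fun t ht => by
      rw [Function.comp_apply, hP]
      exact hG.skew _ (hmem t ht)
  have hU0 : ∀ t ∈ Icc 0 T, ∫ s in 0..t, Z s = 0 := fun t ht => by
    rw [← hQP (∫ s in 0..t, Z s)]
    have := hV t ht
    rw [Function.comp_apply] at this
    rw [this, map_zero]
  intro t ht
  rw [← hZ t ht]
  have h1 : HasDerivWithinAt (fun t => ∫ s in 0..t, Z s) 0 (Icc 0 T) t :=
    (hasDerivWithinAt_const t (Icc 0 T) (0 : H)).congr hU0 (hU0 t ht)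
  exact (uniqueDiffOn_Icc hT t ht).eq_deriv _ (hU t).hasDerivWithinAt h1

end WeightedEvolution

/-! ### The Maxwell system with a matrix weight. -/

section MaxwellSystem

variable {𝕜 : Type*} [RCLike 𝕜] {D : Set R3}

/-- The inclusion `u ↦ (u, 0)`. -/
def pairInl (𝕜 : Type*) [RCLike 𝕜] (D : Set R3) : L2Field 𝕜 D →L[ℝ] FieldPair 𝕜 D :=
  ((WithLp.prodContinuousLinearEquiv 2 ℝ (L2Field 𝕜 D) (L2Field 𝕜 D)).symm :
    _ →L[ℝ] FieldPair 𝕜 D).comp (ContinuousLinearMap.inl ℝ (L2Field 𝕜 D) (L2Field 𝕜 D))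

/-- The inclusion `u ↦ (0, u)`. -/
def pairInr (𝕜 : Type*) [RCLike 𝕜] (D : Set R3) : L2Field 𝕜 D →L[ℝ] FieldPair 𝕜 D :=
  ((WithLp.prodContinuousLinearEquiv 2 ℝ (L2Field 𝕜 D) (L2Field 𝕜 D)).symm :
    _ →L[ℝ] FieldPair 𝕜 D).comp (ContinuousLinearMap.inr ℝ (L2Field 𝕜 D) (L2Field 𝕜 D))

lemma pairInl_apply (u : L2Field 𝕜 D) : pairInl 𝕜 D u = WithLp.toLp 2 (u, 0) := rfl

lemma norm_pairInl (u : L2Field 𝕜 D) : ‖pairInl 𝕜 D u‖ = ‖u‖ := by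
  rw [pairInl_apply, WithLp.norm_toLp_fst]

lemma pairInl_add_pairInr (u v : L2Field 𝕜 D) :
    pairInl 𝕜 D u + pairInr 𝕜 D v = WithLp.toLp 2 (u, v) := by
  change WithLp.toLp 2 (u + 0, 0 + v) = _
  rw [add_zero, zero_add]

/-- The operator `(E, H) ↦ (a N E, b N H)`. -/
def pairOp (a b : ℝ) (N : L2Field 𝕜 D →L[ℝ] L2Field 𝕜 D) :
    FieldPair 𝕜 D →L[ℝ] FieldPair 𝕜 D :=
  ((WithLp.prodContinuousLinearEquiv 2 ℝ (L2Field 𝕜 D) (L2Field 𝕜 D)).symm :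
    _ →L[ℝ] FieldPair 𝕜 D).comp (((a • N).prodMap (b • N)).comp
      (WithLp.prodContinuousLinearEquiv 2 ℝ (L2Field 𝕜 D) (L2Field 𝕜 D) :
        FieldPair 𝕜 D →L[ℝ] _))

lemma pairOp_apply (a b : ℝ) (N : L2Field 𝕜 D →L[ℝ] L2Field 𝕜 D) (z : FieldPair 𝕜 D) :
    pairOp a b N z = WithLp.toLp 2 (a • N z.fst, b • N z.snd) := rfl

lemma pairOp_pairOp {a b a' b' : ℝ} (ha : a * a' = 1) (hb : b * b' = 1)
    {N M : L2Field 𝕜 D →L[ℝ] L2Field 𝕜 D} (h : ∀ u, N (M u) = u) (z : FieldPair 𝕜 D) :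
    pairOp a b N (pairOp a' b' M z) = z := by
  rw [pairOp_apply, pairOp_apply]
  simp only [WithLp.toLp_fst, WithLp.toLp_snd, map_smul, h, smul_smul, ha, hb, one_smul]
  rfl

lemma pairOp_pairOp_self {a b : ℝ} (ha : 0 ≤ a) (hb : 0 ≤ b)
    (N : L2Field 𝕜 D →L[ℝ] L2Field 𝕜 D) (z : FieldPair 𝕜 D) :
    pairOp (Real.sqrt a) (Real.sqrt b) N (pairOp (Real.sqrt a) (Real.sqrt b) N z) =
      WithLp.toLp 2 (a • N (N z.fst), b • N (N z.snd)) := by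
  rw [pairOp_apply, pairOp_apply]
  simp only [WithLp.toLp_fst, WithLp.toLp_snd, map_smul, smul_smul, Real.mul_self_sqrt ha,
    Real.mul_self_sqrt hb]

lemma inner_pairOp (a b : ℝ) {N : L2Field 𝕜 D →L[ℝ] L2Field 𝕜 D}
    (hN : ∀ u v, inner ℝ (N u) v = inner ℝ u (N v)) (x y : FieldPair 𝕜 D) :
    inner ℝ (pairOp a b N x) y = inner ℝ x (pairOp a b N y) := by
  rw [WithLp.prod_inner_apply, WithLp.prod_inner_apply, pairOp_apply, pairOp_apply]
  simp only [inner_smul_left, inner_smul_right, conj_trivial]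
  rw [hN, hN]
  rfl

lemma norm_pairOp_le {a b c k : ℝ} (ha : |a| ≤ c) (hb : |b| ≤ c)
    {N : L2Field 𝕜 D →L[ℝ] L2Field 𝕜 D} (hN : ∀ u, ‖N u‖ ≤ k * ‖u‖) (hk : 0 ≤ k)
    (z : FieldPair 𝕜 D) : ‖pairOp a b N z‖ ≤ c * k * ‖z‖ := by
  have hc : 0 ≤ c := (abs_nonneg a).trans ha
  refine le_of_sq_le_sq ?_ (by positivity)
  have h1 : ∀ (d : ℝ) (u : L2Field 𝕜 D), |d| ≤ c → ‖d • N u‖ ^ 2 ≤ (c * k) ^ 2 * ‖u‖ ^ 2 := by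
    intro d u hd
    rw [← mul_pow, norm_smul, mul_assoc]
    exact pow_le_pow_left₀ (by positivity) (mul_le_mul hd (hN u) (norm_nonneg _) hc) 2
  rw [WithLp.prod_norm_sq_eq_of_L2, pairOp_apply, mul_pow, WithLp.prod_norm_sq_eq_of_L2 z,
    mul_add]
  exact add_le_add (h1 a _ ha) (h1 b _ hb)

variable {ε μ k T : ℝ} {N M : L2Field 𝕜 D →L[ℝ] L2Field 𝕜 D}

/-- Existence for the Maxwell system `ε N² e = ∇ × H - J`, `μ N² h = -∇ × E`, where `e`, `h` are
the time derivatives of `E`, `H`. -/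
theorem exists_maxwell (hD : IsOpen D) (hε : 0 < ε) (hμ : 0 < μ) (hk : 0 ≤ k)
    (hNM : ∀ u, N (M u) = u) (hMN : ∀ u, M (N u) = u)
    (hN : ∀ u v, inner ℝ (N u) v = inner ℝ u (N v)) (hMk : ∀ u, ‖M u‖ ≤ k * ‖u‖)
    (hT : 0 ≤ T) {v : ℝ → L2Field 𝕜 D} (hv : IntervalIntegrable v volume 0 T) :
    ∃ e h : ℝ → L2Field 𝕜 D, Continuous e ∧ Continuous h ∧ ∀ t ∈ Icc 0 T,
      IsWeakCurl D (∫ s in 0..t, h s) (ε • N (N (e t)) + ∫ s in 0..t, v s) ∧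
      IsAdjointCurl D (∫ s in 0..t, e s) (-(μ • N (N (h t)))) ∧
      ‖e t‖ ≤ (max (Real.sqrt ε)⁻¹ (Real.sqrt μ)⁻¹ * k) ^ 2 * ∫ s in 0..T, ‖v s‖ ∧
      ‖h t‖ ≤ (max (Real.sqrt ε)⁻¹ (Real.sqrt μ)⁻¹ * k) ^ 2 * ∫ s in 0..T, ‖v s‖ := by
  have hsε : 0 < Real.sqrt ε := Real.sqrt_pos.2 hε
  have hsμ : 0 < Real.sqrt μ := Real.sqrt_pos.2 hμ
  -- `v` plays the role of `∂ₜJ`; the source acts only in the electric equation.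
  have hf : IntervalIntegrable (fun s => -pairInl 𝕜 D (v s)) volume 0 T :=
    (hv.clm_comp (pairInl 𝕜 D)).neg
  have hQ : ∀ z, ‖pairOp (Real.sqrt ε)⁻¹ (Real.sqrt μ)⁻¹ M z‖ ≤
      max (Real.sqrt ε)⁻¹ (Real.sqrt μ)⁻¹ * k * ‖z‖ :=
    norm_pairOp_le ((abs_of_pos (inv_pos.2 hsε)).trans_le (le_max_left _ _))
      ((abs_of_pos (inv_pos.2 hsμ)).trans_le (le_max_right _ _)) hMk hk
  obtain ⟨ζ, hζ, h⟩ := (isSkewAdjointGraph_maxwell (𝕜 := 𝕜) hD).exists_weighted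
    (P := pairOp (Real.sqrt ε) (Real.sqrt μ) N) (Q := pairOp (Real.sqrt ε)⁻¹ (Real.sqrt μ)⁻¹ M)
    (pairOp_pairOp (mul_inv_cancel₀ hsε.ne') (mul_inv_cancel₀ hsμ.ne') hNM)
    (pairOp_pairOp (inv_mul_cancel₀ hsε.ne') (inv_mul_cancel₀ hsμ.ne') hMN)
    (inner_pairOp _ _ hN) (by positivity) hQ hT hf
  have hF : Continuous fun z : FieldPair 𝕜 D => z.fst :=
    (WithLp.fstL 2 ℝ (L2Field 𝕜 D) (L2Field 𝕜 D)).continuous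
  have hS : Continuous fun z : FieldPair 𝕜 D => z.snd :=
    (WithLp.sndL 2 ℝ (L2Field 𝕜 D) (L2Field 𝕜 D)).continuous
  refine ⟨fun t => (ζ t).fst, fun t => (ζ t).snd, hF.comp hζ, hS.comp hζ, fun t ht => ?_⟩
  obtain ⟨h1, h2⟩ := h t ht
  have hvt : IntervalIntegrable v volume 0 t :=
    hv.mono_set (by rw [uIcc_of_le ht.1, uIcc_of_le hT]; exact Icc_subset_Icc_right ht.2)
  have hfst : ∫ s in 0..t, (ζ s).fst = (∫ s in 0..t, ζ s).fst :=
    (WithLp.fstL 2 ℝ (L2Field 𝕜 D) (L2Field 𝕜 D)).intervalIntegral_comp_comm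
      (hζ.intervalIntegrable _ _)
  have hsnd : ∫ s in 0..t, (ζ s).snd = (∫ s in 0..t, ζ s).snd :=
    (WithLp.sndL 2 ℝ (L2Field 𝕜 D) (L2Field 𝕜 D)).intervalIntegral_comp_comm
      (hζ.intervalIntegrable _ _)
  have hint : ∫ s in 0..t, -pairInl 𝕜 D (v s) = -pairInl 𝕜 D (∫ s in 0..t, v s) := by
    rw [intervalIntegral.integral_neg, (pairInl 𝕜 D).intervalIntegral_comp_comm hvt]
  have hnorm : ∫ s in 0..T, ‖-pairInl 𝕜 D (v s)‖ = ∫ s in 0..T, ‖v s‖ :=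
    intervalIntegral.integral_congr fun s _ => by
      rw [norm_neg, norm_pairInl]
  rw [hnorm] at h2
  rw [hint, sub_neg_eq_add, pairOp_pairOp_self hε.le hμ.le, pairInl_apply, ← WithLp.toLp_add,
    Prod.mk_add_mk, add_zero] at h1
  obtain ⟨h3, h4⟩ := mem_maxwellGraph.1 h1
  rw [hfst, hsnd]
  exact ⟨h3, h4, (WithLp.norm_fst_le _ (ζ t)).trans h2, (WithLp.norm_snd_le _ (ζ t)).trans h2⟩

/-- Uniqueness for the Maxwell system. -/
theorem maxwell_unique (hD : IsOpen D) (hε : 0 < ε) (hμ : 0 < μ)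
    (hMN : ∀ u, M (N u) = u) (hN : ∀ u v, inner ℝ (N u) v = inner ℝ u (N v))
    (hT : 0 < T) {E H e h : ℝ → L2Field 𝕜 D} (he : IntervalIntegrable e volume 0 T)
    (hh : IntervalIntegrable h volume 0 T) (hE : ∀ t ∈ Icc 0 T, E t = ∫ s in 0..t, e s)
    (hH : ∀ t ∈ Icc 0 T, H t = ∫ s in 0..t, h s)
    (hc : ∀ᵐ t ∂(volume.restrict (Ioo 0 T)), IsWeakCurl D (H t) (ε • N (N (e t))) ∧
      IsAdjointCurl D (E t) (-(μ • N (N (h t))))) :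
    ∀ t ∈ Icc 0 T, E t = 0 ∧ H t = 0 := by
  have hsε : 0 < Real.sqrt ε := Real.sqrt_pos.2 hε
  have hsμ : 0 < Real.sqrt μ := Real.sqrt_pos.2 hμ
  have hz := (isSkewAdjointGraph_maxwell (𝕜 := 𝕜) hD).eq_zero_of_weighted
    (P := pairOp (Real.sqrt ε) (Real.sqrt μ) N) (Q := pairOp (Real.sqrt ε)⁻¹ (Real.sqrt μ)⁻¹ M)
    (pairOp_pairOp (inv_mul_cancel₀ hsε.ne') (inv_mul_cancel₀ hsμ.ne') hMN)
    (inner_pairOp _ _ hN) hT (z := fun t => (pairInl 𝕜 D) (E t) + (pairInr 𝕜 D) (H t))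
    (ζ := fun t => (pairInl 𝕜 D) (e t) + (pairInr 𝕜 D) (h t))
    ((he.clm_comp (pairInl 𝕜 D)).add (hh.clm_comp (pairInr 𝕜 D)))
    (fun t ht => by
      have hsub : uIcc 0 t ⊆ uIcc 0 T := by
        rw [uIcc_of_le ht.1, uIcc_of_le hT.le]; exact Icc_subset_Icc_right ht.2
      rw [intervalIntegral.integral_add ((he.mono_set hsub).clm_comp (pairInl 𝕜 D))
        ((hh.mono_set hsub).clm_comp (pairInr 𝕜 D)),
        (pairInl 𝕜 D).intervalIntegral_comp_comm (he.mono_set hsub),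
        (pairInr 𝕜 D).intervalIntegral_comp_comm (hh.mono_set hsub), hE t ht, hH t ht])
    (by
      filter_upwards [hc] with t ht
      rw [pairInl_add_pairInr, pairInl_add_pairInr, pairOp_pairOp_self hε.le hμ.le]
      exact mem_maxwellGraph.2 ht)
  intro t ht
  have := hz t ht
  simp only [pairInl_add_pairInr] at this
  exact ⟨congrArg WithLp.fst this, congrArg WithLp.snd this⟩

end MaxwellSystem

/-! ### Reformulation of the PML problem, uniqueness, and the final estimate. -/

section Main

variable {𝕜 : Type*} [RCLike 𝕜] {D : Set R3}

lemma IsWeakCurl.sub {u w u' w' : L2Field 𝕜 D} (h : IsWeakCurl D u w) (h' : IsWeakCurl D u' w') :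
    IsWeakCurl D (u - u') (w - w') := by
  rw [isWeakCurl_iff] at *
  intro φ h1 h2 h3
  rw [inner_sub_right, inner_sub_right, h φ h1 h2 h3, h' φ h1 h2 h3]

lemma IsAdjointCurl.sub {u w u' w' : L2Field 𝕜 D} (h : IsAdjointCurl D u w)
    (h' : IsAdjointCurl D u' w') : IsAdjointCurl D (u - u') (w - w') := fun v z hv => by
  rw [inner_sub_left, inner_sub_left, h v z hv, h' v z hv]

lemma isAdjointCurl_weakCurl (hD : IsOpen D) {u : L2Field 𝕜 D} (h : u ∈ HCurl0 𝕜 D) :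
    IsAdjointCurl D u (weakCurl D u) := by
  obtain ⟨w, hw⟩ := (mem_HCurl0_iff hD).1 h
  rwa [hw.isWeakCurl.weakCurl_eq hD]

lemma isOpen_truncDomain (Ω : Set R3) (ρ : ℝ) : IsOpen (truncDomain Ω ρ) :=
  Metric.isOpen_ball.sdiff isClosed_closure

variable {σ₀ R ρ T : ℝ} {m : ℕ}

lemma faraday_iff (hσ : 0 < σ₀) (hR : R < ρ) (hT : 0 < T) (μ : ℝ) (c w : L2Field 𝕜 D) :
    (∀ᵐ x ∂(volume.restrict D), c x + μ • medium (1 / T) σ₀ R ρ m x (w x) = 0) ↔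
      c = -(μ • (sqrtWeight hσ hR hT m).op 𝕜 D ((sqrtWeight hσ hR hT m).op 𝕜 D w)) := by
  set z := (sqrtWeight hσ hR hT m).op 𝕜 D ((sqrtWeight hσ hR hT m).op 𝕜 D w) with hz
  have h1 : z =ᵐ[volume.restrict D] fun x => medium (1 / T) σ₀ R ρ m x (w x) :=
    sqrtWeight_op_op_ae hσ hR hT w
  have h2 : (-(μ • z) : L2Field 𝕜 D) =ᵐ[volume.restrict D]
      fun x => -(μ • medium (1 / T) σ₀ R ρ m x (w x)) := by
    filter_upwards [h1, Lp.coeFn_neg (μ • z), Lp.coeFn_smul μ z] with x e1 e2 e3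
    rw [e2, Pi.neg_apply, e3, Pi.smul_apply, e1]
  constructor
  · intro h
    refine Lp.ext ?_
    filter_upwards [h, h2] with x e1 e2
    rw [e2]
    exact eq_neg_of_add_eq_zero_left e1
  · intro h
    filter_upwards [h2] with x e2
    rw [h, e2, neg_add_cancel]

lemma ampere_iff (hσ : 0 < σ₀) (hR : R < ρ) (hT : 0 < T) (ε : ℝ) (c w j : L2Field 𝕜 D) :
    (∀ᵐ x ∂(volume.restrict D), c x - ε • medium (1 / T) σ₀ R ρ m x (w x) = j x) ↔
      c = ε • (sqrtWeight hσ hR hT m).op 𝕜 D ((sqrtWeight hσ hR hT m).op 𝕜 D w) + j := by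
  set z := (sqrtWeight hσ hR hT m).op 𝕜 D ((sqrtWeight hσ hR hT m).op 𝕜 D w) with hz
  have h1 : z =ᵐ[volume.restrict D] fun x => medium (1 / T) σ₀ R ρ m x (w x) :=
    sqrtWeight_op_op_ae hσ hR hT w
  have h2 : (ε • z + j : L2Field 𝕜 D) =ᵐ[volume.restrict D]
      fun x => ε • medium (1 / T) σ₀ R ρ m x (w x) + j x := by
    filter_upwards [h1, Lp.coeFn_add (ε • z) j, Lp.coeFn_smul ε z] with x e1 e2 e3
    rw [e2, Pi.add_apply, e3, Pi.smul_apply, e1]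
  constructor
  · intro h
    refine Lp.ext ?_
    filter_upwards [h, h2] with x e1 e2
    rw [e2, add_comm]
    exact sub_eq_iff_eq_add.1 e1
  · intro h
    filter_upwards [h2] with x e2
    rw [h, e2, add_sub_cancel_left]

lemma norm_sqrtWeight_op_op_le (hσ : 0 < σ₀) (hR : R < ρ) (hT : 0 < T) (u : L2Field 𝕜 D) :
    ‖(sqrtWeight hσ hR hT m).op 𝕜 D ((sqrtWeight hσ hR hT m).op 𝕜 D u)‖ ≤
      (1 + σ₀ * T) * ‖u‖ := by
  have h1 := (sqrtWeight hσ hR hT m).norm_op_apply_le u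
  have h2 := (sqrtWeight hσ hR hT m).norm_op_apply_le ((sqrtWeight hσ hR hT m).op 𝕜 D u)
  refine h2.trans ((mul_le_mul_of_nonneg_left h1 (Real.sqrt_nonneg _)).trans_eq ?_)
  change Real.sqrt (1 + σ₀ * T) * (Real.sqrt (1 + σ₀ * T) * ‖u‖) = _
  rw [← mul_assoc, Real.mul_self_sqrt (by positivity)]

/-- Bookkeeping with `κ = 1 + σ₀T`: the time derivatives `a`, `b` carry one power of `κ`, the curls
`cE`, `cH` a second one, and `κ ≥ 1` raises every term to `κ ^ 2`. -/
lemma sum_le_of_energy_bounds {ε μ c κ I S a b cE cH : ℝ} (hε : 0 ≤ ε) (hμ : 0 ≤ μ) (hκ : 1 ≤ κ)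
    (hI : 0 ≤ I) (ha : a ≤ c ^ 2 * κ * I) (hb : b ≤ c ^ 2 * κ * I) (hE : cE ≤ μ * (κ * b))
    (hH : cH ≤ ε * (κ * a) + I) (hS : I ≤ S) :
    a + cE + b + cH ≤ (2 * c ^ 2 + (ε + μ) * c ^ 2 + 1) * κ ^ 2 * S := by
  have hκ2 : κ ≤ κ ^ 2 := by nlinarith
  have h1 : c ^ 2 * κ * I ≤ c ^ 2 * κ ^ 2 * I := by gcongr
  have h2 : I ≤ κ ^ 2 * I := le_mul_of_one_le_left hI (by nlinarith)
  have h3 : μ * (κ * b) ≤ μ * (κ * (c ^ 2 * κ * I)) := by gcongr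
  have h4 : ε * (κ * a) ≤ ε * (κ * (c ^ 2 * κ * I)) := by gcongr
  calc a + cE + b + cH ≤ (2 * c ^ 2 + (ε + μ) * c ^ 2 + 1) * κ ^ 2 * I := by linarith
    _ ≤ _ := mul_le_mul_of_nonneg_left hS (by positivity)

/-- The `L¹(0,T)` norm of the derivative is controlled by the `H¹(0,T)` norm. -/
lemma integral_norm_weakTimeDeriv_le {X : Type*} [NormedAddCommGroup X] [NormedSpace ℝ X]
    (hT : 0 ≤ T) {u : ℝ → X} (hu : MemH1 T u) :
    ∫ s in 0..T, ‖weakTimeDeriv T u s‖ ≤ Real.sqrt T * H1Norm T u := by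
  have hv := (isWeakTimeDeriv_weakTimeDeriv hu.2.2).1
  have hi1 : Integrable (fun t => ‖u t‖ ^ 2) (volume.restrict (Ioo 0 T)) :=
    hu.2.1.norm.integrable_sq
  have hi2 : Integrable (fun t => ‖weakTimeDeriv T u t‖ ^ 2) (volume.restrict (Ioo 0 T)) :=
    hv.norm.integrable_sq
  have hpq : Real.HolderConjugate 2 2 := Real.HolderConjugate.two_two
  -- Cauchy-Schwarz against the constant `1`, whose `L²(0,T)` norm is `√T`.
  have h := integral_mul_le_Lp_mul_Lq_of_nonneg hpq (μ := volume.restrict (Ioo 0 T))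
    (f := fun _ => (1 : ℝ)) (g := fun t => ‖weakTimeDeriv T u t‖)
    (ae_of_all _ fun _ => zero_le_one) (ae_of_all _ fun _ => norm_nonneg _)
    (memLp_const 1) (by simpa using hv.norm)
  simp only [one_mul, integral_const, smul_eq_mul, Real.rpow_ofNat, one_pow, mul_one,
    MeasurableSet.univ, measureReal_restrict_apply, univ_inter, Real.volume_real_Ioo_of_le hT,
    sub_zero, ← Real.sqrt_eq_rpow] at h
  rw [← integral_Ioo_eq_interval hT]
  refine h.trans (mul_le_mul_of_nonneg_left (Real.sqrt_le_sqrt ?_) (Real.sqrt_nonneg _))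
  exact integral_mono hi2 (hi1.add hi2) fun t => le_add_of_nonneg_left (by positivity)

/-- Two solutions of the Maxwell system with the same source agree. -/
theorem maxwell_eqOn {ε μ : ℝ} {N M : L2Field 𝕜 D →L[ℝ] L2Field 𝕜 D} (hD : IsOpen D)
    (hε : 0 < ε) (hμ : 0 < μ) (hMN : ∀ u, M (N u) = u)
    (hN : ∀ u v, inner ℝ (N u) v = inner ℝ u (N v)) (hT : 0 < T)
    {J E₁ H₁ E₂ H₂ e₁ h₁ e₂ h₂ : ℝ → L2Field 𝕜 D}
    (he₁ : IntervalIntegrable e₁ volume 0 T) (hh₁ : IntervalIntegrable h₁ volume 0 T)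
    (he₂ : IntervalIntegrable e₂ volume 0 T) (hh₂ : IntervalIntegrable h₂ volume 0 T)
    (hE₁ : ∀ t ∈ Icc 0 T, E₁ t = ∫ s in 0..t, e₁ s) (hH₁ : ∀ t ∈ Icc 0 T, H₁ t = ∫ s in 0..t, h₁ s)
    (hE₂ : ∀ t ∈ Icc 0 T, E₂ t = ∫ s in 0..t, e₂ s) (hH₂ : ∀ t ∈ Icc 0 T, H₂ t = ∫ s in 0..t, h₂ s)
    (h₁' : ∀ᵐ t ∂(volume.restrict (Ioo 0 T)), IsWeakCurl D (H₁ t) (ε • N (N (e₁ t)) + J t) ∧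
      IsAdjointCurl D (E₁ t) (-(μ • N (N (h₁ t)))))
    (h₂' : ∀ᵐ t ∂(volume.restrict (Ioo 0 T)), IsWeakCurl D (H₂ t) (ε • N (N (e₂ t)) + J t) ∧
      IsAdjointCurl D (E₂ t) (-(μ • N (N (h₂ t))))) :
    EqOn E₂ E₁ (Icc 0 T) ∧ EqOn H₂ H₁ (Icc 0 T) := by
  have hsub : ∀ {t}, t ∈ Icc 0 T → uIcc 0 t ⊆ uIcc 0 T := fun ht => by
    rw [uIcc_of_le ht.1, uIcc_of_le hT.le]; exact Icc_subset_Icc_right ht.2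
  have hcurl : ∀ᵐ t ∂(volume.restrict (Ioo 0 T)),
      IsWeakCurl D (H₂ t - H₁ t) (ε • N (N (e₂ t - e₁ t))) ∧
      IsAdjointCurl D (E₂ t - E₁ t) (-(μ • N (N (h₂ t - h₁ t)))) := by
    filter_upwards [h₁', h₂'] with t c₁ c₂
    have hH := c₂.1.sub c₁.1
    have hE := c₂.2.sub c₁.2
    rw [map_sub, map_sub, map_sub, map_sub, smul_sub, smul_sub, neg_sub']
    rw [add_sub_add_right_eq_sub] at hH
    exact ⟨hH, hE⟩
  have key := maxwell_unique hD hε hμ hMN hN hT (he₂.sub he₁) (hh₂.sub hh₁)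
    (fun t ht => by
      rw [hE₂ t ht, hE₁ t ht]
      exact (intervalIntegral.integral_sub (he₂.mono_set (hsub ht)) (he₁.mono_set (hsub ht))).symm)
    (fun t ht => by
      rw [hH₂ t ht, hH₁ t ht]
      exact (intervalIntegral.integral_sub (hh₂.mono_set (hsub ht)) (hh₁.mono_set (hsub ht))).symm)
    hcurl
  exact ⟨fun t ht => sub_eq_zero.1 (key t ht).1, fun t ht => sub_eq_zero.1 (key t ht).2⟩

lemma IsSolution.curl_ae {ε μ : ℝ} (hσ : 0 < σ₀) (hR : R < ρ) (hT : 0 < T) {Ω : Set R3}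
    {J E H : ℝ → L2Field 𝕜 (truncDomain Ω ρ)}
    (h : IsSolution ε μ (1 / T) σ₀ R ρ T m Ω J E H) :
    ∀ᵐ t ∂(volume.restrict (Ioo 0 T)),
      IsWeakCurl (truncDomain Ω ρ) (H t)
        (ε • (sqrtWeight hσ hR hT m).op 𝕜 _ ((sqrtWeight hσ hR hT m).op 𝕜 _
          (weakTimeDeriv T E t)) + J t) ∧
      IsAdjointCurl (truncDomain Ω ρ) (E t)
        (-(μ • (sqrtWeight hσ hR hT m).op 𝕜 _ ((sqrtWeight hσ hR hT m).op 𝕜 _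
          (weakTimeDeriv T H t)))) := by
  filter_upwards [h.faraday, h.ampere, h.E_space.1, h.H_space.1] with t h1 h2 h3 h4
  rw [← (faraday_iff hσ hR hT μ _ _).1 h1, ← (ampere_iff hσ hR hT ε _ _ _).1 h2]
  exact ⟨isWeakCurl_weakCurl h4, isAdjointCurl_weakCurl (isOpen_truncDomain Ω ρ) h3⟩

/-- Solutions of the truncated PML problem are unique. -/
theorem IsSolution.eqOn {ε μ : ℝ} (hε : 0 < ε) (hμ : 0 < μ) (hσ : 0 < σ₀) (hR : R < ρ)
    (hT : 0 < T) {Ω : Set R3} {J E₁ H₁ E₂ H₂ : ℝ → L2Field 𝕜 (truncDomain Ω ρ)}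
    (h₂ : IsSolution ε μ (1 / T) σ₀ R ρ T m Ω J E₂ H₂)
    (h₁ : IsSolution ε μ (1 / T) σ₀ R ρ T m Ω J E₁ H₁) :
    EqOn E₂ E₁ (Icc 0 T) ∧ EqOn H₂ H₁ (Icc 0 T) := by
  have hint : ∀ {u : ℝ → L2Field 𝕜 (truncDomain Ω ρ)}, MemH1 T u →
      IntervalIntegrable (weakTimeDeriv T u) volume 0 T := fun hu =>
    intervalIntegrable_of_memLp hT.le (isWeakTimeDeriv_weakTimeDeriv hu.2.2).1
  have hftc : ∀ {u : ℝ → L2Field 𝕜 (truncDomain Ω ρ)}, MemH1 T u → u 0 = 0 →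
      ∀ t ∈ Icc 0 T, u t = ∫ s in 0..t, weakTimeDeriv T u s := fun hu h0 t ht => by
    rw [eq_add_integral_of_isWeakTimeDeriv hT hu.1 (isWeakTimeDeriv_weakTimeDeriv hu.2.2) t ht,
      h0, zero_add]
  exact maxwell_eqOn (isOpen_truncDomain Ω ρ) hε hμ (invSqrtWeight_op_sqrtWeight hσ hR hT)
    (sqrtWeight hσ hR hT m).inner_op hT (hint h₁.E_time) (hint h₁.H_time) (hint h₂.E_time)
    (hint h₂.H_time) (hftc h₁.E_time h₁.E_init) (hftc h₁.H_time h₁.H_init)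
    (hftc h₂.E_time h₂.E_init) (hftc h₂.H_time h₂.H_init) (h₁.curl_ae hσ hR hT)
    (h₂.curl_ae hσ hR hT)

end Main

end PML

end

/-! ### Well-posedness and stability of the truncated PML problem. -/

theorem mainTheorem2 {𝕜 : Type*} [RCLike 𝕜] (ε μ : ℝ) (hε : 0 < ε) (hμ : 0 < μ) :
    ∃ C : ℝ, 0 < C ∧
      ∀ (Ω : Set PML.R3) (R ρ σ₀ T : ℝ) (m : ℕ),
        IsOpen Ω → closure Ω ⊆ Metric.ball 0 R → 0 < R → R < ρ → 0 < σ₀ → 1 ≤ m → 0 < T →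
      ∀ J : ℝ → PML.L2Field 𝕜 (PML.truncDomain Ω ρ),
        PML.MemH1 T J → J 0 = 0 →
        (∀ᵐ t ∂(volume.restrict (Ioo 0 T)),
          ∀ᵐ x ∂(volume.restrict (PML.truncDomain Ω ρ)), R ≤ ‖x‖ → J t x = 0) →
      ∃ E H : ℝ → PML.L2Field 𝕜 (PML.truncDomain Ω ρ),
        PML.IsSolution ε μ (1 / T) σ₀ R ρ T m Ω J E H ∧
        (∀ E₂ H₂ : ℝ → PML.L2Field 𝕜 (PML.truncDomain Ω ρ),
          PML.IsSolution ε μ (1 / T) σ₀ R ρ T m Ω J E₂ H₂ →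
            EqOn E₂ E (Icc 0 T) ∧ EqOn H₂ H (Icc 0 T)) ∧
        ContDiffOn ℝ 1 E (Icc 0 T) ∧ ContDiffOn ℝ 1 H (Icc 0 T) ∧
        (∀ t ∈ Icc 0 T, E t ∈ PML.HCurl0 𝕜 (PML.truncDomain Ω ρ) ∧
          H t ∈ PML.HCurl 𝕜 (PML.truncDomain Ω ρ)) ∧
        ContinuousOn (fun t => PML.weakCurl (PML.truncDomain Ω ρ) (E t)) (Icc 0 T) ∧
        ContinuousOn (fun t => PML.weakCurl (PML.truncDomain Ω ρ) (H t)) (Icc 0 T) ∧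
        ∀ t ∈ Icc 0 T,
          ‖derivWithin E (Icc 0 T) t‖ + ‖PML.weakCurl (PML.truncDomain Ω ρ) (E t)‖
            + ‖derivWithin H (Icc 0 T) t‖ + ‖PML.weakCurl (PML.truncDomain Ω ρ) (H t)‖
          ≤ C * max 1 (Real.sqrt T) * (1 + σ₀ * T) ^ 2 * PML.H1Norm T J := by
  set c := max (Real.sqrt ε)⁻¹ (Real.sqrt μ)⁻¹
  refine ⟨2 * c ^ 2 + (ε + μ) * c ^ 2 + 1, by positivity, ?_⟩
  intro Ω R ρ σ₀ T m _ _ _ hR hσ _ hT J hJ hJ0 _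
  have hD : IsOpen (PML.truncDomain Ω ρ) := PML.isOpen_truncDomain Ω ρ
  set N := (PML.sqrtWeight hσ hR hT m).op 𝕜 (PML.truncDomain Ω ρ)
  set M := (PML.invSqrtWeight hσ hR hT m).op 𝕜 (PML.truncDomain Ω ρ)
  have hNM : ∀ u, N (M u) = u := PML.sqrtWeight_op_invSqrtWeight hσ hR hT
  have hMN : ∀ u, M (N u) = u := PML.invSqrtWeight_op_sqrtWeight hσ hR hT
  have hN : ∀ u v, inner ℝ (N u) v = inner ℝ u (N v) := (PML.sqrtWeight hσ hR hT m).inner_op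
  have hNN : ∀ u, ‖N (N u)‖ ≤ (1 + σ₀ * T) * ‖u‖ := PML.norm_sqrtWeight_op_op_le hσ hR hT
  have hM : ∀ u, ‖M u‖ ≤ Real.sqrt (1 + σ₀ * T) * ‖u‖ :=
    (PML.invSqrtWeight hσ hR hT m).norm_op_apply_le
  have hJw := PML.isWeakTimeDeriv_weakTimeDeriv hJ.2.2
  set v := PML.weakTimeDeriv T J
  have hv : IntervalIntegrable v volume 0 T := PML.intervalIntegrable_of_memLp hT.le hJw.1
  -- `J(0) = 0` enters here: the integrated source is `J` itself, so the integrated form of the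
  -- differentiated system is the original system.
  have hJv : ∀ t ∈ Icc 0 T, ∫ s in 0..t, v s = J t := fun t ht => by
    rw [PML.eq_add_integral_of_isWeakTimeDeriv hT hJ.1 hJw t ht, hJ0, zero_add]
  obtain ⟨e, h, hec, hhc, hsol⟩ := PML.exists_maxwell hD hε hμ (Real.sqrt_nonneg _) hNM hMN hN hM
    hT.le hv
  have hNNc : Continuous fun u => N (N u) := N.continuous.comp N.continuous
  let E : ℝ → PML.L2Field 𝕜 (PML.truncDomain Ω ρ) := fun t => ∫ s in 0..t, e s
  let H : ℝ → PML.L2Field 𝕜 (PML.truncDomain Ω ρ) := fun t => ∫ s in 0..t, h s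
  have hE : ∀ t, HasDerivAt E (e t) t := PML.hasDerivAt_integral hec
  have hH : ∀ t, HasDerivAt H (h t) t := PML.hasDerivAt_integral hhc
  have hEc : Continuous E := continuous_iff_continuousAt.2 fun t => (hE t).continuousAt
  have hHc : Continuous H := continuous_iff_continuousAt.2 fun t => (hH t).continuousAt
  have hHcurl : ∀ t ∈ Icc 0 T,
      PML.IsWeakCurl (PML.truncDomain Ω ρ) (H t) (ε • N (N (e t)) + J t) := fun t ht => by
    rw [← hJv t ht]; exact (hsol t ht).1
  have hEcurl : ∀ t ∈ Icc 0 T,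
      PML.IsAdjointCurl (PML.truncDomain Ω ρ) (E t) (-(μ • N (N (h t)))) := fun t ht =>
    (hsol t ht).2.1
  -- At every time the curls are bounded operators applied to `e`, `h`, plus `J`; this yields their
  -- continuity and their bounds.
  have hwE : ∀ t ∈ Icc 0 T,
      PML.weakCurl (PML.truncDomain Ω ρ) (E t) = -(μ • N (N (h t))) := fun t ht =>
    (hEcurl t ht).isWeakCurl.weakCurl_eq hD
  have hwH : ∀ t ∈ Icc 0 T,
      PML.weakCurl (PML.truncDomain Ω ρ) (H t) = ε • N (N (e t)) + J t := fun t ht =>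
    (hHcurl t ht).weakCurl_eq hD
  have hE0 : ∀ t ∈ Icc 0 T, E t ∈ PML.HCurl0 𝕜 (PML.truncDomain Ω ρ) := fun t ht =>
    (PML.mem_HCurl0_iff hD).2 ⟨_, hEcurl t ht⟩
  have hH0 : ∀ t ∈ Icc 0 T, H t ∈ PML.HCurl 𝕜 (PML.truncDomain Ω ρ) := fun t ht => ⟨_, hHcurl t ht⟩
  have hcE : ContinuousOn (fun t => PML.weakCurl (PML.truncDomain Ω ρ) (E t)) (Icc 0 T) :=
    (((hNNc.comp hhc).const_smul μ).neg.continuousOn).congr hwE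
  have hcH : ContinuousOn (fun t => PML.weakCurl (PML.truncDomain Ω ρ) (H t)) (Icc 0 T) :=
    (((hNNc.comp hec).const_smul ε).continuousOn.add hJ.1).congr hwH
  have hEw := PML.isWeakTimeDeriv_of_hasDerivAt hT.le hE hec
  have hHw := PML.isWeakTimeDeriv_of_hasDerivAt hT.le hH hhc
  have hIoo : ∀ {p : ℝ → Prop}, (∀ t ∈ Icc 0 T, p t) → ∀ᵐ t ∂(volume.restrict (Ioo 0 T)), p t :=
    fun hp => (ae_restrict_iff' measurableSet_Ioo).2
      (ae_of_all _ fun t ht => hp t (Ioo_subset_Icc_self ht))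
  have hIsSol : PML.IsSolution ε μ (1 / T) σ₀ R ρ T m Ω J E H := by
    refine ⟨⟨hIoo hE0, PML.memLp_Ioo_of_continuousOn hEc.continuousOn,
        PML.memLp_Ioo_of_continuousOn hcE⟩,
      ⟨hEc.continuousOn, PML.memLp_Ioo_of_continuousOn hEc.continuousOn, _, hEw⟩,
      ⟨hIoo hH0, PML.memLp_Ioo_of_continuousOn hHc.continuousOn,
        PML.memLp_Ioo_of_continuousOn hcH⟩,
      ⟨hHc.continuousOn, PML.memLp_Ioo_of_continuousOn hHc.continuousOn, _, hHw⟩, ?_, ?_,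
      hIoo fun t ht => PML.HCurl0_subset_HCurlZeroOn _ (hE0 t ht),
      hIoo fun t ht => PML.HCurl0_subset_HCurlZeroOn _ (hE0 t ht),
      intervalIntegral.integral_same, intervalIntegral.integral_same⟩
    · filter_upwards [PML.weakTimeDeriv_ae_eq hHw, hIoo hwE] with t h1 h2
      rw [h1]
      exact (PML.faraday_iff hσ hR hT μ _ _).2 h2
    · filter_upwards [PML.weakTimeDeriv_ae_eq hEw, hIoo hwH] with t h1 h2
      rw [h1]
      exact (PML.ampere_iff hσ hR hT ε _ _ _).2 h2
  refine ⟨E, H, hIsSol, fun E₂ H₂ hs => hs.eqOn hε hμ hσ hR hT hIsSol, ?_, ?_,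
    fun t ht => ⟨hE0 t ht, hH0 t ht⟩, hcE, hcH, ?_⟩
  · refine (contDiff_one_iff_deriv.2 ⟨fun t => (hE t).differentiableAt, ?_⟩).contDiffOn
    rwa [funext fun t => (hE t).deriv]
  · refine (contDiff_one_iff_deriv.2 ⟨fun t => (hH t).differentiableAt, ?_⟩).contDiffOn
    rwa [funext fun t => (hH t).deriv]
  · intro t ht
    have hu := uniqueDiffOn_Icc hT t ht
    rw [(hE t).hasDerivWithinAt.derivWithin hu, (hH t).hasDerivWithinAt.derivWithin hu,
      hwE t ht, hwH t ht]
    have hκ1 : 1 ≤ 1 + σ₀ * T := by nlinarith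
    have hI0 : 0 ≤ ∫ s in 0..T, ‖v s‖ :=
      intervalIntegral.integral_nonneg hT.le fun _ _ => norm_nonneg _
    have hck : (c * Real.sqrt (1 + σ₀ * T)) ^ 2 = c ^ 2 * (1 + σ₀ * T) := by
      rw [mul_pow, Real.sq_sqrt (by linarith)]
    -- The source term in `∇ × H` is measured by the `L¹` norm of `∂ₜJ`, like all other terms.
    have hJt : ‖J t‖ ≤ ∫ s in 0..T, ‖v s‖ := by
      rw [← hJv t ht]
      exact (intervalIntegral.norm_integral_le_integral_norm ht.1).trans
        (intervalIntegral.integral_mono_interval le_rfl ht.1 ht.2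
          (Filter.Eventually.of_forall fun _ => norm_nonneg _) hv.norm)
    have hcE : ‖-(μ • N (N (h t)))‖ ≤ μ * ((1 + σ₀ * T) * ‖h t‖) := by
      rw [norm_neg, norm_smul, Real.norm_of_nonneg hμ.le]
      exact mul_le_mul_of_nonneg_left (hNN _) hμ.le
    have hcH : ‖ε • N (N (e t)) + J t‖ ≤
        ε * ((1 + σ₀ * T) * ‖e t‖) + ∫ s in 0..T, ‖v s‖ := by
      refine (norm_add_le _ _).trans (add_le_add ?_ hJt)
      rw [norm_smul, Real.norm_of_nonneg hε.le]
      exact mul_le_mul_of_nonneg_left (hNN _) hε.le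
    have ha : ‖e t‖ ≤ c ^ 2 * (1 + σ₀ * T) * ∫ s in 0..T, ‖v s‖ :=
      hck ▸ (hsol t ht).2.2.1
    have hb : ‖h t‖ ≤ c ^ 2 * (1 + σ₀ * T) * ∫ s in 0..T, ‖v s‖ :=
      hck ▸ (hsol t ht).2.2.2
    refine (PML.sum_le_of_energy_bounds hε.le hμ.le hκ1 hI0 ha hb hcE hcH
      ((PML.integral_norm_weakTimeDeriv_le hT.le hJ).trans
        (mul_le_mul_of_nonneg_right (le_max_right 1 _) (Real.sqrt_nonneg _)))).trans_eq ?_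
    ring
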